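/- Let $n,m\ge 1$, $q=\min\{n,m\}$, $1\le r\le q$, $\gamma>0$ and $Z\in\mathbb R^{n\times m}$. For $X\in\mathbb R^{n\times m}$ let $\sigma_1(X)\ge\dots\ge\sigma_q(X)$ be its singular values, counted with multiplicity, with the convention $\sigma_{q+1}(X):=0$, and let $\langle X,Y\rangle=\operatorname{trace}(X^TY)$ and $\|X\|_{\ell_2}=\sqrt{\langle X,X\rangle}$. Let $g:\mathbb R^q\to\mathbb R_{\ge0}$ be a symmetric gauge function, i.e. a norm that is invariant under entrywise absolute values and under permutations of the entries, and put $\|X\|_g:=g(\sigma_1(X),\dots,\sigma_q(X))$. The dual norm $M\mapsto\max_{\|X\|_g\le1}\langle M,X\rangle$ is again unitarily invariant; let $g^D$ be its symmetric gauge function, so that this dual norm equals $g^D(\sigma_1(M),\dots,\sigma_q(M))$. Put $\|X\|_{g^D,r}:=g^D(\sigma_1(X),\dots,\sigma_r(X),0,\dots,0)$, and let $\|\cdot\|_{g,r*}$ be the dual norm of $\|\cdot\|_{g^D,r}$, that is, $\|M\|_{g,r*}=\max_{\|X\|_{g^D,r}\le1}\langle M,X\rangle$. Let $k:\mathbb R_{\ge0}\to\mathbb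 R\cup\{\infty\}$ be proper (not identically $\infty$), closed (all sublevel sets $\{x: k(x)\le\alpha\}$, $\alpha\in\mathbb R$, are closed), convex and increasing (nondecreasing and not constant). Let $f_1(M):=k(\|M\|_g)$ if $\operatorname{rank}(M)\le r$ and $f_1(M):=\infty$ otherwise. For $f:\mathbb R^{n\times m}\to\mathbb R\cup\{\infty\}$ let $\operatorname{prox}_f(Z)$ be the set of all minimizers of $M\mapsto f(M)+\tfrac12\|M-Z\|_{\ell_2}^2$. Let $\operatorname{svd}_r(Z)$ be the set of all matrices $\sum_{i=1}^r\sigma_i(Z)u_iv_i^T$, where $Z=\sum_{i=1}^q\sigma_i(Z)u_iv_i^T$ is a singular value decomposition of $Z$ (with $u_1,\dots,u_q$ orthonormal and $v_1,\dots,v_q$ orthonormal). Then for every $P\in\operatorname{svd}_r(Z)$ there is a matrix $X$ with $$\operatorname{prox}_{\gamma k(\|\cdot\|_g)}(P)=\operatorname{prox}_{\gamma k(\|\cdot\|_{g,r*})}(P)=\{X\}\quad\text{and}\quad X\in\operatorname{prox}_{\gamma f_1}(Z).$$ Moreover, $\operatorname{prox}_{\gamma k(\|\cdot\|_{g,r*})}(Z)=\{M^c\}$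 for a (unique) matrix $M^c$, and the following are equivalent: 1. $\operatorname{prox}_{\gamma f_1}(Z)=\{M^c\}$; 2. $\operatorname{rank}(M^c)\le r$; 3. $\sigma_{r+j}(Z-M^c)=\sigma_{r+j}(Z)$ for all $j\in\{1,\dots,q-r\}$; 4. $\sigma_r(Z-M^c)\ge\sigma_{r+1}(Z)$. -/

import Mathlib

open scoped NNReal Matrix

noncomputable section

namespace LowRankProx

/-- The `i`-th largest singular value `σ_i(X)`, counted from `i = 1` and with multiplicity
(so `σ_i(X) = 0` for `i > min n m`). -/
def sigma {n m : ℕ} (X : Matrix (Fin n) (Fin m) ℝ) (i : ℕ) : ℝ :=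
  (Matrix.toEuclideanLin X).singularValues (i - 1)

/-- The vector `(σ_1(X), …, σ_q(X))` with `q = min n m`. -/
def sigmaVec {n m : ℕ} (X : Matrix (Fin n) (Fin m) ℝ) : Fin (min n m) → ℝ :=
  fun i => sigma X (i + 1)

/-- The inner product `⟨X, Y⟩ = trace (Xᵀ Y)`. -/
def matInner {n m : ℕ} (X Y : Matrix (Fin n) (Fin m) ℝ) : ℝ := (Xᵀ * Y).trace

/-- The Frobenius norm. -/
def frobNorm {n m : ℕ} (X : Matrix (Fin n) (Fin m) ℝ) : ℝ := Real.sqrt (matInner X X)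

/-- `u`, `v` are left and right singular vectors of a singular value decomposition
`Z = ∑_{i ≤ q} σ_i(Z) u_i v_iᵀ`. -/
structure IsSVD {n m : ℕ} (Z : Matrix (Fin n) (Fin m) ℝ)
    (u : Fin (min n m) → EuclideanSpace ℝ (Fin n))
    (v : Fin (min n m) → EuclideanSpace ℝ (Fin m)) : Prop where
  orthonormal_left : Orthonormal ℝ u
  orthonormal_right : Orthonormal ℝ v
  eq_sum : Z = ∑ i, sigmaVec Z i • Matrix.vecMulVec (u i) (v i)

/-- The set `svd_r(Z)` of all truncations `∑_{i ≤ r} σ_i(Z) u_i v_iᵀ` of singular value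
decompositions of `Z` (a singleton when `σ_r(Z) ≠ σ_{r+1}(Z)`). -/
def svdTrunc {n m : ℕ} (r : ℕ) (Z : Matrix (Fin n) (Fin m) ℝ) :
    Set (Matrix (Fin n) (Fin m) ℝ) :=
  {P | ∃ u v, IsSVD Z u v ∧
    P = ∑ i : Fin (min n m),
      if (i : ℕ) < r then sigmaVec Z i • Matrix.vecMulVec (u i) (v i) else 0}

/-- Symmetric gauge functions on `ℝ^q`: norms that are invariant under entrywise absolute values
and under permutations of the entries. -/
structure IsSymmetricGauge {q : ℕ} (g : (Fin q → ℝ) → ℝ) : Prop where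
  nonneg : ∀ x, 0 ≤ g x
  eq_zero_iff : ∀ x, g x = 0 ↔ x = 0
  smul : ∀ (c : ℝ) (x), g (c • x) = |c| * g x
  add_le : ∀ x y, g (x + y) ≤ g x + g y
  abs : ∀ x, g (fun i => |x i|) = g x
  perm : ∀ (τ : Equiv.Perm (Fin q)) (x), g (x ∘ τ) = g x

/-- The unitarily invariant norm `‖X‖_g = g(σ_1(X), …, σ_q(X))`. -/
def gaugeNorm {n m : ℕ} (g : (Fin (min n m) → ℝ) → ℝ) (X : Matrix (Fin n) (Fin m) ℝ) : ℝ :=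
  g (sigmaVec X)

/-- The dual norm `M ↦ max {⟨M, X⟩ : N X ≤ 1}` of a norm `N` on matrices. -/
def dualNorm {n m : ℕ} (N : Matrix (Fin n) (Fin m) ℝ → ℝ) (M : Matrix (Fin n) (Fin m) ℝ) : ℝ :=
  sSup {t : ℝ | ∃ X : Matrix (Fin n) (Fin m) ℝ, N X ≤ 1 ∧ t = matInner M X}

/-- The `n × m` matrix with diagonal entries `x_1, …, x_q` and zeros elsewhere. -/
def rectDiag {n m : ℕ} (x : Fin (min n m) → ℝ) : Matrix (Fin n) (Fin m) ℝ :=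
  fun i j => if h : (i : ℕ) = (j : ℕ) then x ⟨i, lt_min i.2 (h ▸ j.2)⟩ else 0

/-- The symmetric gauge function `g^D` of the unitarily invariant norm dual to `‖·‖_g`
(its value at `x` is the value of that dual norm at the matrix with diagonal `x`). -/
def dualGauge {n m : ℕ} (g : (Fin (min n m) → ℝ) → ℝ) (x : Fin (min n m) → ℝ) : ℝ :=
  dualNorm (gaugeNorm g) (rectDiag x : Matrix (Fin n) (Fin m) ℝ)

/-- The norm `‖X‖_{g^D,r} = g^D(σ_1(X), …, σ_r(X), 0, …, 0)`. -/
def truncDualNorm {n m : ℕ} (g : (Fin (min n m) → ℝ) → ℝ) (r : ℕ)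
    (X : Matrix (Fin n) (Fin m) ℝ) : ℝ :=
  dualGauge g (fun i => if (i : ℕ) < r then sigmaVec X i else 0)

/-- The low-rank inducing norm `‖·‖_{g,r*}`, the dual norm of `‖·‖_{g^D,r}`. -/
def lowRankNorm {n m : ℕ} (g : (Fin (min n m) → ℝ) → ℝ) (r : ℕ) :
    Matrix (Fin n) (Fin m) ℝ → ℝ :=
  dualNorm (truncDualNorm g r)

/-- The composition `k(N(·))` of `k : ℝ≥0 → ℝ ∪ {∞}` with a (nonnegative) norm `N`. -/
def compNorm {n m : ℕ} (k : ℝ≥0 → EReal) (N : Matrix (Fin n) (Fin m) ℝ → ℝ)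
    (M : Matrix (Fin n) (Fin m) ℝ) : EReal :=
  k (N M).toNNReal

open Classical in
/-- The indicator function of a set in the sense of convex analysis. -/
def chi {n m : ℕ} (S : Set (Matrix (Fin n) (Fin m) ℝ)) (M : Matrix (Fin n) (Fin m) ℝ) : EReal :=
  if M ∈ S then 0 else ⊤

/-- `f_1 = k(‖·‖_g) + χ_{rank ≤ r}`. -/
def rankConstrained {n m : ℕ} (k : ℝ≥0 → EReal) (g : (Fin (min n m) → ℝ) → ℝ) (r : ℕ)
    (M : Matrix (Fin n) (Fin m) ℝ) : EReal :=
  compNorm k (gaugeNorm g) M + chi {X | X.rank ≤ r} M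

/-- The proximal mapping as a set: all minimizers of `M ↦ f M + ½ ‖M - Z‖²`
(Frobenius norm). -/
def prox {n m : ℕ} (f : Matrix (Fin n) (Fin m) ℝ → EReal) (Z : Matrix (Fin n) (Fin m) ℝ) :
    Set (Matrix (Fin n) (Fin m) ℝ) :=
  {M | ∀ N, f M + ((1 / 2 * frobNorm (M - Z) ^ 2 : ℝ) : EReal) ≤
    f N + ((1 / 2 * frobNorm (N - Z) ^ 2 : ℝ) : EReal)}

/-- Proper, closed, convex and increasing functions `k : ℝ≥0 → ℝ ∪ {∞}`. Increasing means
monotone and not constant. -/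
structure IsProperClosedConvexIncreasing (k : ℝ≥0 → EReal) : Prop where
  ne_bot : ∀ x, k x ≠ ⊥
  proper : ∃ x, k x ≠ ⊤
  closed : ∀ α : ℝ, IsClosed {x | k x ≤ (α : EReal)}
  convex : ∀ (x y s t : ℝ≥0), 0 < s → 0 < t → s + t = 1 →
    k (s * x + t * y) ≤ ((s : ℝ) : EReal) * k x + ((t : ℝ) : EReal) * k y
  monotone : Monotone k
  nonconstant : ∃ x y, k x < k y

end LowRankProx

end

noncomputable section

namespace LowRankProx

/-! Von Neumann's trace inequality (`matInner_expand_le`) reduces everything to vectors: exchanging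
the singular vectors of a candidate for those of Z keeps every unitarily invariant value and does
not increase the distance to Z. Unique proximal points of spectral functions are therefore diagonal
in any SVD of Z (`eq_expand_of_prox_eq_singleton`).

The low-rank inducing norm dominates the gauge norm and equals it on rank at most r. Hence a unique
minimizer for the smaller function that has rank at most r is also the unique minimizer for the
larger one (`prox_eq_singleton_of_le`). At a truncation P the gauge proximal point X has rank at
most r, since truncating coefficients increases neither the gauge nor the distance to P; so both
convex problems at P have solution X. By Pythagoras the squared distances to Z and to P differ by a
constant on rank-r candidates aligned with Z, so X solves the nonconvex problem.

For the equivalences, let w = σ(Z) - σ(M^c). The residual Z - M^c is normal to a ball of the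
low-rank norm (`matInner_sub_le_of_mem_prox`); testing sign flips and swaps shows that w is
nonnegative and nonincreasing, hence w = σ(Z - M^c). Normality also makes the pairing of M^c with
the residual attain the product of the norm and the dual norm, and the dual norm sees only w_1, …,
w_r. If the gap condition 4 held with rank above r, raising w_{r+1} to w_r would keep the dual norm
but strictly increase the pairing, a contradiction (`rank_le_of_residual_gap`). The other
implications are short. -/

/-! ### Rearrangement inequalities for substochastic matrices -/

/-- Abel summation: a nonnegative nonincreasing weight preserves nonnegativity of partial sums. -/
theorem sum_mul_nonneg_of_partial_sums_nonneg {q : ℕ} {a c : Fin q → ℝ} (ha : Antitone a)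
    (ha0 : ∀ i, 0 ≤ a i) (hc : ∀ k, 0 ≤ ∑ i, if i ≤ k then c i else 0) :
    0 ≤ ∑ i, a i * c i := by
  let A : ℕ → ℝ := fun i => if h : i < q then a ⟨i, h⟩ else 0
  -- `A` extends `a` by zero, so each `a i` telescopes into the later decrements, the last one being
  -- the final entry itself.
  have hA : ∀ i : Fin q, a i = ∑ k : Fin q, if i ≤ k then A k - A (k + 1) else 0 := by
    intro i
    simp only [Fin.le_def]
    rw [Fin.sum_univ_eq_sum_range (fun k => if (i : ℕ) ≤ k then A k - A (k + 1) else 0) q,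
      ← Finset.sum_filter]
    have hf : (Finset.range q).filter (fun k => (i : ℕ) ≤ k) = Finset.Ico (i : ℕ) q := by
      ext k; simp [and_comm]
    rw [hf, ← neg_inj, ← Finset.sum_neg_distrib]
    simp only [neg_sub]
    rw [Finset.sum_Ico_sub A i.2.le]
    simp [A]
  have hd : ∀ k : Fin q, 0 ≤ A k - A (k + 1) := by
    intro k
    by_cases h : (k : ℕ) + 1 < q
    · have := ha (show k ≤ ⟨k + 1, h⟩ from Fin.le_def.2 (Nat.le_succ _))
      simp [A, h, this]
    · simp [A, h, ha0 k]
  have : ∑ i, a i * c i =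
      ∑ k : Fin q, (A k - A (k + 1)) * ∑ i, if i ≤ k then c i else 0 := by
    simp_rw [Finset.mul_sum]
    rw [Finset.sum_comm]
    refine Finset.sum_congr rfl fun i _ => ?_
    rw [hA i, Finset.sum_mul]
    refine Finset.sum_congr rfl fun k _ => ?_
    split_ifs <;> simp
  rw [this]
  exact Finset.sum_nonneg fun k _ => mul_nonneg (hd k) (hc k)

/-- The bilinear form of a doubly substochastic matrix on nonincreasing nonnegative vectors is
bounded by their dot product. -/
theorem sum_substochastic_le {q : ℕ} {S : Fin q → Fin q → ℝ} (hS : ∀ i j, 0 ≤ S i j)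
    (hrow : ∀ i, ∑ j, S i j ≤ 1) (hcol : ∀ j, ∑ i, S i j ≤ 1) {a b : Fin q → ℝ}
    (ha : Antitone a) (ha0 : ∀ i, 0 ≤ a i) (hb : Antitone b) (hb0 : ∀ i, 0 ≤ b i) :
    ∑ i, ∑ j, a i * b j * S i j ≤ ∑ i, a i * b i := by
  have key : 0 ≤ ∑ i, a i * (b i - ∑ j, b j * S i j) := by
    refine sum_mul_nonneg_of_partial_sums_nonneg ha ha0 fun k => ?_
    have : (∑ i, if i ≤ k then b i - ∑ j, b j * S i j else 0) =
        ∑ j, b j * ((if j ≤ k then 1 else 0) - ∑ i, if i ≤ k then S i j else 0) := by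
      simp_rw [mul_sub, Finset.sum_sub_distrib, Finset.mul_sum]
      rw [Finset.sum_comm (f := fun x i => b x * if i ≤ k then S i x else 0),
        ← Finset.sum_sub_distrib]
      refine Finset.sum_congr rfl fun i _ => ?_
      split_ifs <;> simp
    rw [this]
    refine sum_mul_nonneg_of_partial_sums_nonneg hb hb0 fun l => ?_
    have e : (∑ j, if j ≤ l then ((if j ≤ k then (1 : ℝ) else 0) - ∑ i, if i ≤ k then S i j else 0)
        else 0) = (∑ j, if j ≤ l then (if j ≤ k then (1 : ℝ) else 0) else 0) -
          ∑ j, if j ≤ l then (∑ i, if i ≤ k then S i j else 0) else 0 := by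
      rw [← Finset.sum_sub_distrib]
      refine Finset.sum_congr rfl fun j _ => ?_
      split_ifs <;> simp
    rw [e, sub_nonneg]
    -- The block sum of `S` must be at most the shorter side of the block: column sums bound it when
    -- `l ≤ k`, row sums otherwise.
    rcases le_total l k with h | h
    · refine Finset.sum_le_sum fun j _ => ?_
      split_ifs with h1 h2
      · refine le_trans (Finset.sum_le_sum fun i _ => ?_) (hcol j)
        split_ifs
        · exact le_rfl
        · exact hS i j
      · exact absurd (h1.trans h) h2
      · exact le_rfl
    · have e1 : (∑ j, if j ≤ l then (∑ i, if i ≤ k then S i j else 0) else 0) =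
          ∑ i, if i ≤ k then (∑ j, if j ≤ l then S i j else 0) else 0 := by
        have e2 : ∀ j, (if j ≤ l then (∑ i, if i ≤ k then S i j else 0) else 0) =
            ∑ i, if i ≤ k then (if j ≤ l then S i j else 0) else 0 := by
          intro j
          split_ifs <;> simp
        simp_rw [e2]
        rw [Finset.sum_comm]
        refine Finset.sum_congr rfl fun i _ => ?_
        split_ifs <;> simp
      rw [e1]
      refine Finset.sum_le_sum fun i _ => ?_
      by_cases h1 : i ≤ k
      · simp only [h1, h1.trans h, if_true]
        refine le_trans (Finset.sum_le_sum fun j _ => ?_) (hrow i)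
        split_ifs
        · exact le_rfl
        · exact hS i j
      · simp [h1]
  have : ∑ i, a i * (b i - ∑ j, b j * S i j) =
      ∑ i, a i * b i - ∑ i, ∑ j, a i * b j * S i j := by
    simp_rw [mul_sub, Finset.sum_sub_distrib, Finset.mul_sum, mul_assoc]
  linarith

/-! ### The Frobenius inner product -/

variable {n m : ℕ}

theorem matInner_comm (X Y : Matrix (Fin n) (Fin m) ℝ) : matInner X Y = matInner Y X := by
  unfold matInner
  rw [← Matrix.trace_transpose, Matrix.transpose_mul, Matrix.transpose_transpose]

theorem matInner_add_left (X Y W : Matrix (Fin n) (Fin m) ℝ) :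
    matInner (X + Y) W = matInner X W + matInner Y W := by
  simp [matInner, Matrix.add_mul]

theorem matInner_add_right (X Y W : Matrix (Fin n) (Fin m) ℝ) :
    matInner W (X + Y) = matInner W X + matInner W Y := by
  simp [matInner, Matrix.mul_add]

theorem matInner_sub_left (X Y W : Matrix (Fin n) (Fin m) ℝ) :
    matInner (X - Y) W = matInner X W - matInner Y W := by
  simp [matInner, Matrix.sub_mul]

theorem matInner_sub_right (X Y W : Matrix (Fin n) (Fin m) ℝ) :
    matInner W (X - Y) = matInner W X - matInner W Y := by
  simp [matInner, Matrix.mul_sub]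

theorem matInner_smul_left (c : ℝ) (X W : Matrix (Fin n) (Fin m) ℝ) :
    matInner (c • X) W = c * matInner X W := by
  simp [matInner]

theorem matInner_smul_right (c : ℝ) (X W : Matrix (Fin n) (Fin m) ℝ) :
    matInner W (c • X) = c * matInner W X := by
  simp [matInner]

theorem matInner_sum_left {ι : Type*} (s : Finset ι) (f : ι → Matrix (Fin n) (Fin m) ℝ)
    (W : Matrix (Fin n) (Fin m) ℝ) : matInner (∑ i ∈ s, f i) W = ∑ i ∈ s, matInner (f i) W := by
  simp [matInner, Matrix.sum_mul, Matrix.transpose_sum, Matrix.trace_sum]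

theorem matInner_sum_right {ι : Type*} (s : Finset ι) (f : ι → Matrix (Fin n) (Fin m) ℝ)
    (W : Matrix (Fin n) (Fin m) ℝ) : matInner W (∑ i ∈ s, f i) = ∑ i ∈ s, matInner W (f i) := by
  simp [matInner, Matrix.mul_sum, Matrix.trace_sum]

theorem matInner_eq_sum (X Y : Matrix (Fin n) (Fin m) ℝ) :
    matInner X Y = ∑ i, ∑ j, X i j * Y i j := by
  rw [Finset.sum_comm]
  simp [matInner, Matrix.trace, Matrix.mul_apply]

theorem matInner_self_nonneg (X : Matrix (Fin n) (Fin m) ℝ) : 0 ≤ matInner X X := by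
  rw [matInner_eq_sum]
  exact Finset.sum_nonneg fun i _ => Finset.sum_nonneg fun j _ => mul_self_nonneg _

theorem matInner_self_eq_zero {X : Matrix (Fin n) (Fin m) ℝ} (h : matInner X X = 0) : X = 0 := by
  rw [matInner_eq_sum] at h
  ext i j
  have h1 := (Finset.sum_eq_zero_iff_of_nonneg
    fun i _ => Finset.sum_nonneg fun j _ => mul_self_nonneg (X i j)).1 h i (Finset.mem_univ _)
  have h2 := (Finset.sum_eq_zero_iff_of_nonneg
    fun j _ => mul_self_nonneg (X i j)).1 h1 j (Finset.mem_univ _)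
  simpa using h2

theorem frobNorm_sq (X : Matrix (Fin n) (Fin m) ℝ) : frobNorm X ^ 2 = matInner X X :=
  Real.sq_sqrt (matInner_self_nonneg X)

theorem matInner_vecMulVec (u u' : EuclideanSpace ℝ (Fin n)) (v v' : EuclideanSpace ℝ (Fin m)) :
    matInner (Matrix.vecMulVec u v) (Matrix.vecMulVec u' v') = inner ℝ u u' * inner ℝ v v' := by
  simp only [matInner_eq_sum, Matrix.vecMulVec_apply, PiLp.inner_apply, Finset.sum_mul_sum]
  refine Finset.sum_congr rfl fun i _ => Finset.sum_congr rfl fun j _ => ?_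
  simp
  ring

/-! ### Expansions in orthonormal families and the trace inequality -/

/-- The matrix `∑ x_i u_i v_iᵀ`. -/
def expand {q : ℕ} (u : Fin q → EuclideanSpace ℝ (Fin n))
    (v : Fin q → EuclideanSpace ℝ (Fin m)) (x : Fin q → ℝ) : Matrix (Fin n) (Fin m) ℝ :=
  ∑ i, x i • Matrix.vecMulVec (u i) (v i)

section expand
variable {q : ℕ} {u u' : Fin q → EuclideanSpace ℝ (Fin n)}
  {v v' : Fin q → EuclideanSpace ℝ (Fin m)}

theorem expand_sub (x y : Fin q → ℝ) : expand u v (x - y) = expand u v x - expand u v y := by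
  simp [expand, sub_smul, Finset.sum_sub_distrib]

theorem expand_smul (c : ℝ) (x : Fin q → ℝ) : expand u v (c • x) = c • expand u v x := by
  simp [expand, Finset.smul_sum, smul_smul]

theorem expand_comp_perm (τ : Equiv.Perm (Fin q)) (x : Fin q → ℝ) :
    expand (u ∘ τ) (v ∘ τ) (x ∘ τ) = expand u v x :=
  Equiv.sum_comp τ fun i => x i • Matrix.vecMulVec (u i) (v i)

theorem expand_smul_left (ε x : Fin q → ℝ) :
    expand (fun i => ε i • u i) v x = expand u v (fun i => ε i * x i) := by
  unfold expand
  refine Finset.sum_congr rfl fun i _ => ?_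
  ext a b
  simp [Matrix.vecMulVec_apply]
  ring

theorem matInner_expand (x y : Fin q → ℝ) : matInner (expand u v x) (expand u' v' y) =
    ∑ i, ∑ j, x i * y j * (inner ℝ (u i) (u' j) * inner ℝ (v i) (v' j)) := by
  simp only [expand, matInner_sum_left, matInner_sum_right, matInner_smul_left,
    matInner_smul_right, matInner_vecMulVec, Finset.mul_sum]
  rw [Finset.sum_comm]
  exact Finset.sum_congr rfl fun i _ => Finset.sum_congr rfl fun j _ => by ring

theorem matInner_expand_self (hu : Orthonormal ℝ u) (hv : Orthonormal ℝ v) (x y : Fin q → ℝ) :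
    matInner (expand u v x) (expand u v y) = x ⬝ᵥ y := by
  rw [matInner_expand]
  simp [orthonormal_iff_ite.1 hu, orthonormal_iff_ite.1 hv, dotProduct]

/-- Von Neumann's trace inequality. -/
theorem matInner_expand_le (hu : Orthonormal ℝ u) (hv : Orthonormal ℝ v) (hu' : Orthonormal ℝ u')
    (hv' : Orthonormal ℝ v') {a b : Fin q → ℝ} (ha : Antitone a) (ha0 : ∀ i, 0 ≤ a i)
    (hb : Antitone b) (hb0 : ∀ i, 0 ≤ b i) :
    matInner (expand u v a) (expand u' v' b) ≤ a ⬝ᵥ b := by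
  rw [matInner_expand]
  -- By AM-GM the product of two inner products is at most the mean of their squares; by Bessel
  -- these means form a substochastic matrix.
  refine le_trans (Finset.sum_le_sum fun i _ => Finset.sum_le_sum fun j _ =>
    mul_le_mul_of_nonneg_left
      (?_ : _ ≤ (inner ℝ (u i) (u' j) ^ 2 + inner ℝ (v i) (v' j) ^ 2) / 2)
      (mul_nonneg (ha0 i) (hb0 j)))
    (sum_substochastic_le (fun i j => by positivity) (fun i => ?_) (fun j => ?_) ha ha0 hb hb0)
  · nlinarith [sq_nonneg (inner ℝ (u i) (u' j) - inner ℝ (v i) (v' j))]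
  · have h1 := hu'.sum_inner_products_le (u i) (s := Finset.univ)
    have h2 := hv'.sum_inner_products_le (v i) (s := Finset.univ)
    simp only [Real.norm_eq_abs, sq_abs, hu.1 i, hv.1 i, real_inner_comm (u i),
      real_inner_comm (v i)] at h1 h2
    rw [← Finset.sum_div, Finset.sum_add_distrib]
    linarith
  · have h1 := hu.sum_inner_products_le (u' j) (s := Finset.univ)
    have h2 := hv.sum_inner_products_le (v' j) (s := Finset.univ)
    simp only [Real.norm_eq_abs, sq_abs, hu'.1 j, hv'.1 j] at h1 h2
    rw [← Finset.sum_div, Finset.sum_add_distrib]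
    linarith

/-- Sorted nonnegative coefficients of expansions in orthonormal families are unique. -/
theorem expand_coeff_unique (hu : Orthonormal ℝ u) (hv : Orthonormal ℝ v)
    (hu' : Orthonormal ℝ u') (hv' : Orthonormal ℝ v') {a b : Fin q → ℝ} (ha : Antitone a)
    (ha0 : ∀ i, 0 ≤ a i) (hb : Antitone b) (hb0 : ∀ i, 0 ≤ b i)
    (h : expand u v a = expand u' v' b) : a = b := by
  -- Indicators of initial segments serve as test coefficients: the trace inequality, used both
  -- ways, equates all partial sums of `a` and `b`.
  have hk : ∀ k : Fin q, Antitone fun i : Fin q => if i ≤ k then (1 : ℝ) else 0 := by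
    intro k i j hij
    dsimp only
    split_ifs with h1 h2
    · exact le_rfl
    · exact absurd (hij.trans h1) h2
    · exact zero_le_one
    · exact le_rfl
  have hk0 : ∀ k i : Fin q, 0 ≤ if i ≤ k then (1 : ℝ) else 0 := fun k i => by positivity
  have hle : ∀ k, (∑ i, if i ≤ k then a i else 0) = ∑ i, if i ≤ k then b i else 0 := by
    intro k
    have h1 := matInner_expand_le hu hv hu' hv' ha ha0 (hk k) (hk0 k)
    rw [h, matInner_expand_self hu' hv'] at h1
    have h2 := matInner_expand_le hu' hv' hu hv hb hb0 (hk k) (hk0 k)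
    rw [← h, matInner_expand_self hu hv] at h2
    simpa [dotProduct] using le_antisymm h2 h1
  have hlt : ∀ (c : Fin q → ℝ) (k : Fin q), (∑ i, if i < k then c i else 0) + c k =
      ∑ i, if i ≤ k then c i else 0 := by
    intro c k
    rw [← Finset.sum_filter, ← Finset.sum_filter]
    have : Finset.univ.filter (fun i => i ≤ k) = insert k (Finset.univ.filter (fun i => i < k)) := by
      ext i; simp [le_iff_lt_or_eq, or_comm]
    rw [this, Finset.sum_insert (by simp), add_comm]
  funext k
  induction k using WellFoundedLT.induction with
  | ind k ih =>
    have h1 := hle k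
    rw [← hlt a, ← hlt b] at h1
    have : (∑ i, if i < k then a i else 0) = ∑ i, if i < k then b i else 0 :=
      Finset.sum_congr rfl fun i _ => by
        split_ifs with h
        · exact ih i h
        · rfl
    linarith
end expand

/-! ### Singular values, rank and existence of an SVD -/

theorem sigma_nonneg (X : Matrix (Fin n) (Fin m) ℝ) (i : ℕ) : 0 ≤ sigma X i :=
  LinearMap.singularValues_nonneg _ _

theorem sigmaVec_nonneg (X : Matrix (Fin n) (Fin m) ℝ) (i) : 0 ≤ sigmaVec X i :=
  sigma_nonneg X _

theorem sigmaVec_antitone (X : Matrix (Fin n) (Fin m) ℝ) : Antitone (sigmaVec X) := by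
  intro i j hij
  exact LinearMap.singularValues_antitone _ (by simpa using hij)

theorem rank_le_iff_sigma_eq_zero (X : Matrix (Fin n) (Fin m) ℝ) (r : ℕ) :
    X.rank ≤ r ↔ sigma X (r + 1) = 0 := by
  rw [sigma, add_tsub_cancel_right, LinearMap.singularValues_eq_zero_iff_le_finrank_range,
    Matrix.toEuclideanLin, Matrix.toLpLin_eq_toLin, ← Matrix.rank_eq_finrank_range_toLin]

theorem sigma_eq_zero_of_min_lt (X : Matrix (Fin n) (Fin m) ℝ) {i : ℕ} (h : min n m < i) :
    sigma X i = 0 := by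
  obtain ⟨i, rfl⟩ : ∃ j, i = j + 1 := ⟨i - 1, by omega⟩
  rw [← rank_le_iff_sigma_eq_zero]
  have h1 := X.rank_le_width
  have h2 := X.rank_le_height
  omega

theorem rank_le_iff_sigmaVec (X : Matrix (Fin n) (Fin m) ℝ) (r : ℕ) :
    X.rank ≤ r ↔ ∀ i : Fin (min n m), r ≤ i → sigmaVec X i = 0 := by
  rw [rank_le_iff_sigma_eq_zero]
  constructor
  · intro h i hi
    refine le_antisymm ?_ (sigmaVec_nonneg X i)
    rw [← h]
    exact LinearMap.singularValues_antitone _ (by simpa using hi)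
  · intro h
    by_cases hr : r < min n m
    · exact h ⟨r, hr⟩ le_rfl
    · exact sigma_eq_zero_of_min_lt X (by omega)

theorem toEuclideanLin_expand {q : ℕ} (u : Fin q → EuclideanSpace ℝ (Fin n))
    (v : Fin q → EuclideanSpace ℝ (Fin m)) (a : Fin q → ℝ) (x : EuclideanSpace ℝ (Fin m)) :
    Matrix.toEuclideanLin (expand u v a) x = ∑ i, (a i * inner ℝ (v i) x) • u i := by
  ext k
  simp only [expand, map_sum, map_smul, LinearMap.sum_apply, LinearMap.smul_apply]
  rw [WithLp.ofLp_sum, WithLp.ofLp_sum, Finset.sum_apply, Finset.sum_apply]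
  refine Finset.sum_congr rfl fun i _ => ?_
  simp [Matrix.toLpLin_apply, Matrix.mulVec, Matrix.vecMulVec_apply, dotProduct,
    PiLp.inner_apply, Finset.mul_sum, Finset.sum_mul]
  refine Finset.sum_congr rfl fun j _ => ?_
  ring

/-- Existence of a singular value decomposition. -/
theorem exists_isSVD (X : Matrix (Fin n) (Fin m) ℝ) : ∃ u v, IsSVD X u v := by
  set T := Matrix.toEuclideanLin X with hT
  have hm : Module.finrank ℝ (EuclideanSpace ℝ (Fin m)) = m := by simp
  let b := T.isSymmetric_adjoint_comp_self.eigenvectorBasis hm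
  -- The images of an eigenbasis of `T* T` are orthogonal with lengths the singular values;
  -- normalizing the nonzero ones gives left singular vectors, to be completed to a basis.
  have hb : ∀ i j, inner ℝ (T (b i)) (T (b j)) =
      if i = j then T.singularValues i ^ 2 else 0 := by
    intro i j
    rw [← LinearMap.adjoint_inner_right, ← LinearMap.comp_apply,
      LinearMap.IsSymmetric.apply_eigenvectorBasis, inner_smul_right,
      orthonormal_iff_ite.1 b.orthonormal]
    split_ifs with h
    · subst h
      rw [LinearMap.sq_singularValues_fin _ hm]; simp
    · simp
  let w : Fin n → EuclideanSpace ℝ (Fin n) := fun i =>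
    if h : (i : ℕ) < m then (T.singularValues i)⁻¹ • T (b ⟨i, h⟩) else 0
  let s : Set (Fin n) := {i | T.singularValues i ≠ 0}
  have hs : ∀ i ∈ s, (i : ℕ) < m := by
    intro i hi
    by_contra h
    exact hi (LinearMap.singularValues_of_finrank_le _ (by rw [hm]; omega))
  have hw : Orthonormal ℝ (s.domRestrict w) := by
    rw [orthonormal_iff_ite]
    rintro ⟨i, hi⟩ ⟨j, hj⟩
    have hi0 : T.singularValues i ≠ 0 := hi
    simp only [Set.domRestrict_apply, w, hs i hi, hs j hj, dif_pos, inner_smul_left,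
      inner_smul_right, hb, Subtype.mk.injEq, Fin.ext_iff]
    split_ifs with h
    · rw [← h]; simp; field_simp
    · simp
  obtain ⟨e, he⟩ := hw.exists_orthonormalBasis_extension_of_card_eq (by simp)
  refine ⟨fun k => e (k.castLE (min_le_left _ _)), fun k => b (k.castLE (min_le_right _ _)),
    e.orthonormal.comp _ (Fin.castLE_injective _), b.orthonormal.comp _ (Fin.castLE_injective _), ?_⟩
  change X = expand _ _ (sigmaVec X)
  apply Matrix.toEuclideanLin.injective
  refine b.toBasis.ext fun j => ?_
  rw [toEuclideanLin_expand, OrthonormalBasis.coe_toBasis]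
  have hTj : T.singularValues j = 0 → T (b j) = 0 := fun h => by
    rw [← inner_self_eq_zero (𝕜 := ℝ), hb, if_pos rfl, h]; simp
  by_cases hj : (j : ℕ) < n
  · have hjq : (j : ℕ) < min n m := lt_min hj j.2
    rw [Finset.sum_eq_single (⟨j, hjq⟩ : Fin (min n m))]
    · have : (Fin.castLE (min_le_right n m) ⟨j, hjq⟩) = j := rfl
      rw [this, orthonormal_iff_ite.1 b.orthonormal, if_pos rfl, mul_one]
      change T (b j) = T.singularValues j • e ⟨j, hj⟩
      by_cases h0 : T.singularValues j = 0
      · rw [hTj h0, h0, zero_smul]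
      · rw [he ⟨j, hj⟩ h0]
        simp only [w, j.2, dif_pos, smul_smul, Fin.eta, mul_inv_cancel₀ h0, one_smul]
    · intro k _ hk
      rw [orthonormal_iff_ite.1 b.orthonormal, if_neg, mul_zero, zero_smul]
      intro h
      apply hk
      ext
      simpa [Fin.ext_iff] using h
    · simp
  -- An index `j ≥ n` lies beyond the rank, so both sides vanish.
  · rw [← hT, hTj]
    · symm
      refine Finset.sum_eq_zero fun k _ => ?_
      rw [orthonormal_iff_ite.1 b.orthonormal, if_neg, mul_zero, zero_smul]
      intro h
      have := k.2
      simp only [Fin.ext_iff, Fin.val_castLE] at h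
      omega
    · have := sigma_eq_zero_of_min_lt X (i := j + 1) (by omega)
      simpa [sigma] using this

theorem IsSVD.eq_expand {Z : Matrix (Fin n) (Fin m) ℝ} {u v} (h : IsSVD Z u v) :
    Z = expand u v (sigmaVec Z) := h.eq_sum

/-! ### Singular values of signed and unsorted expansions -/

section
variable {u : Fin (min n m) → EuclideanSpace ℝ (Fin n)}
  {v : Fin (min n m) → EuclideanSpace ℝ (Fin m)}

theorem sigmaVec_expand (hu : Orthonormal ℝ u) (hv : Orthonormal ℝ v) {a : Fin (min n m) → ℝ}
    (ha : Antitone a) (ha0 : ∀ i, 0 ≤ a i) : sigmaVec (expand u v a) = a := by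
  obtain ⟨u', v', h⟩ := exists_isSVD (expand u v a)
  exact (expand_coeff_unique hu hv h.1 h.2 ha ha0 (sigmaVec_antitone _) (sigmaVec_nonneg _)
    h.eq_expand).symm

theorem isSVD_expand (hu : Orthonormal ℝ u) (hv : Orthonormal ℝ v) {a : Fin (min n m) → ℝ}
    (ha : Antitone a) (ha0 : ∀ i, 0 ≤ a i) : IsSVD (expand u v a) u v :=
  ⟨hu, hv, by rw [sigmaVec_expand hu hv ha ha0]; rfl⟩

theorem matInner_le_sigmaVec (X Y : Matrix (Fin n) (Fin m) ℝ) :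
    matInner X Y ≤ sigmaVec X ⬝ᵥ sigmaVec Y := by
  obtain ⟨u, v, h⟩ := exists_isSVD X
  obtain ⟨u', v', h'⟩ := exists_isSVD Y
  nth_rw 1 [h.eq_expand, h'.eq_expand]
  exact matInner_expand_le h.1 h.2 h'.1 h'.2 (sigmaVec_antitone _) (sigmaVec_nonneg _)
    (sigmaVec_antitone _) (sigmaVec_nonneg _)

/-- Every vector is a signed permutation of a sorted nonnegative one. -/
theorem exists_sign_perm {q : ℕ} (x : Fin q → ℝ) : ∃ (ε : Fin q → ℝ) (τ : Equiv.Perm (Fin q)),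
    (∀ i, ε i = 1 ∨ ε i = -1) ∧ (∀ i, x i = ε i * |x i|) ∧ Antitone fun i => |x (τ i)| := by
  refine ⟨fun i => if 0 ≤ x i then 1 else -1, Tuple.sort fun i => -|x i|, fun i => ?_,
    fun i => ?_, fun i j hij => ?_⟩
  · dsimp only; split_ifs <;> simp
  · dsimp only
    split_ifs with h
    · rw [abs_of_nonneg h, one_mul]
    · rw [abs_of_neg (not_le.1 h)]; ring
  · have := Tuple.monotone_sort (fun i => -|x i|) hij
    simpa using this

theorem orthonormal_sign {q : ℕ} {u : Fin q → EuclideanSpace ℝ (Fin n)} (hu : Orthonormal ℝ u)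
    {ε : Fin q → ℝ} (hε : ∀ i, ε i = 1 ∨ ε i = -1) : Orthonormal ℝ fun i => ε i • u i := by
  rw [orthonormal_iff_ite] at hu ⊢
  intro i j
  rw [inner_smul_left, inner_smul_right, hu]
  split_ifs with h
  · subst h; rcases hε i with h | h <;> simp [h]
  · simp

/-- Signs are absorbed into the left vectors, and a permutation only reorders the sum. -/
theorem expand_eq_expand_abs (x : Fin (min n m) → ℝ) {ε : Fin (min n m) → ℝ}
    (hε : ∀ i, x i = ε i * |x i|) (τ : Equiv.Perm (Fin (min n m))) :
    expand u v x = expand (fun i => ε (τ i) • u (τ i)) (v ∘ τ) (fun i => |x (τ i)|) := by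
  have h : expand (fun i => ε i • u i) v (fun i => |x i|) = expand u v x := by
    rw [expand_smul_left]
    exact congrArg _ (funext fun i => (hε i).symm)
  rw [← h, ← expand_comp_perm τ]
  rfl

/-- The singular values of `∑ x_i u_i v_iᵀ` form the sorted vector of absolute values. -/
theorem exists_sigmaVec_expand (hu : Orthonormal ℝ u) (hv : Orthonormal ℝ v)
    (x : Fin (min n m) → ℝ) : ∃ τ : Equiv.Perm (Fin (min n m)), (Antitone fun i => |x (τ i)|) ∧
      sigmaVec (expand u v x) = fun i => |x (τ i)| := by
  obtain ⟨ε, τ, hε, hx, ha⟩ := exists_sign_perm x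
  refine ⟨τ, ha, ?_⟩
  rw [expand_eq_expand_abs x hx τ]
  exact sigmaVec_expand ((orthonormal_sign hu hε).comp τ τ.injective)
    (hv.comp τ τ.injective) ha fun i => abs_nonneg _

/-- Here the sorting permutation is prescribed, which suits the sign flips and swaps applied later
to sorted vectors. -/
theorem sigmaVec_expand_abs_perm (hu : Orthonormal ℝ u) (hv : Orthonormal ℝ v)
    {a x : Fin (min n m) → ℝ} (ha : Antitone a) (ha0 : ∀ i, 0 ≤ a i)
    (τ : Equiv.Perm (Fin (min n m))) (h : ∀ i, |x (τ i)| = a i) :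
    sigmaVec (expand u v x) = a := by
  have hε : ∀ i, (if 0 ≤ x i then (1 : ℝ) else -1) = 1 ∨ (if 0 ≤ x i then (1 : ℝ) else -1) = -1 :=
    fun i => by split_ifs <;> simp
  have hx : ∀ i, x i = (if 0 ≤ x i then (1 : ℝ) else -1) * |x i| := fun i => by
    split_ifs with h
    · rw [abs_of_nonneg h, one_mul]
    · rw [abs_of_neg (not_le.1 h)]; ring
  rw [expand_eq_expand_abs x hx τ, funext h]
  exact sigmaVec_expand ((orthonormal_sign hu hε).comp τ τ.injective)
    (hv.comp τ τ.injective) ha ha0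

/-- The standard diagonal matrix as an expansion. -/
theorem exists_rectDiag_eq_expand : ∃ (u : Fin (min n m) → EuclideanSpace ℝ (Fin n))
    (v : Fin (min n m) → EuclideanSpace ℝ (Fin m)), Orthonormal ℝ u ∧ Orthonormal ℝ v ∧
      ∀ x, rectDiag x = expand u v x := by
  refine ⟨_, _, (EuclideanSpace.basisFun (Fin n) ℝ).orthonormal.comp _
    (Fin.castLE_injective (min_le_left n m)), (EuclideanSpace.basisFun (Fin m) ℝ).orthonormal.comp _
    (Fin.castLE_injective (min_le_right n m)), fun x => ?_⟩
  ext i j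
  simp only [rectDiag, expand, Matrix.sum_apply, Matrix.smul_apply, Matrix.vecMulVec_apply,
    Function.comp, EuclideanSpace.basisFun_apply]
  split_ifs with h
  · rw [Finset.sum_eq_single (⟨i, lt_min i.2 (h ▸ j.2)⟩ : Fin (min n m))]
    · simp [Fin.ext_iff, h]
    · intro k _ hk
      have : ¬ (i : ℕ) = k := fun h' => hk (Fin.ext h'.symm)
      simp [Fin.ext_iff, this]
    · simp
  · symm
    refine Finset.sum_eq_zero fun k _ => ?_
    by_cases hk : (i : ℕ) = k
    · have : ¬ (j : ℕ) = k := fun h' => h (hk.trans h'.symm)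
      simp [Fin.ext_iff, this]
    · simp [Fin.ext_iff, hk]
end

/-! ### Truncation and symmetric gauges -/

/-- Keep the first `r` entries of a vector. -/
def trunc {q : ℕ} (r : ℕ) (x : Fin q → ℝ) : Fin q → ℝ := fun i => if (i : ℕ) < r then x i else 0

theorem trunc_dotProduct {q : ℕ} (r : ℕ) (x y : Fin q → ℝ) :
    trunc r x ⬝ᵥ y = x ⬝ᵥ trunc r y := by
  refine Finset.sum_congr rfl fun i _ => ?_
  unfold trunc
  split_ifs <;> simp

theorem trunc_antitone {q : ℕ} (r : ℕ) {x : Fin q → ℝ} (h : Antitone x) (h0 : ∀ i, 0 ≤ x i) :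
    Antitone (trunc r x) := by
  intro i j hij
  unfold trunc
  have := Fin.le_def.1 hij
  split_ifs with h1 h2
  · exact h hij
  · omega
  · exact h0 i
  · exact le_rfl

theorem trunc_nonneg {q : ℕ} (r : ℕ) {x : Fin q → ℝ} (h0 : ∀ i, 0 ≤ x i) (i) :
    0 ≤ trunc r x i := by
  unfold trunc
  split_ifs
  · exact h0 i
  · exact le_rfl

theorem trunc_eq_self {q : ℕ} (r : ℕ) {x : Fin q → ℝ} (h : ∀ i : Fin q, r ≤ i → x i = 0) :
    trunc r x = x := by
  funext i
  unfold trunc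
  split_ifs with h1
  · rfl
  · exact (h i (not_lt.1 h1)).symm

namespace IsSymmetricGauge
variable {q : ℕ} {g : (Fin q → ℝ) → ℝ} (hg : IsSymmetricGauge g)
include hg

theorem zero : g 0 = 0 := (hg.eq_zero_iff 0).2 rfl

theorem congr_abs_perm {x y : Fin q → ℝ} (τ : Equiv.Perm (Fin q)) (h : ∀ i, |x (τ i)| = |y i|) :
    g x = g y := by
  rw [← hg.abs x, ← hg.perm τ, ← hg.abs y]
  exact congrArg g (funext h)

theorem congr_abs {x y : Fin q → ℝ} (h : ∀ i, |x i| = |y i|) : g x = g y :=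
  hg.congr_abs_perm 1 h

/-- The restricted vector is the average of `x` and its reflection in the discarded coordinates,
which has the same gauge. -/
theorem restrict_le (p : Fin q → Prop) [DecidablePred p] (x : Fin q → ℝ) :
    g (fun i => if p i then x i else 0) ≤ g x := by
  have h1 : g (fun i => if p i then x i else -x i) = g x :=
    hg.congr_abs fun i => by split_ifs <;> simp
  have h2 := hg.add_le x (fun i => if p i then x i else -x i)
  have h3 : x + (fun i => if p i then x i else -x i) =
      (2 : ℝ) • (fun i => if p i then x i else 0) := by
    funext i
    simp only [Pi.add_apply, Pi.smul_apply, smul_eq_mul]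
    split_ifs <;> ring
  rw [h3, hg.smul, h1, abs_two] at h2
  linarith

theorem trunc_le (r : ℕ) (x : Fin q → ℝ) : g (trunc r x) ≤ g x := hg.restrict_le _ x

theorem pos_single (i : Fin q) : 0 < g (Pi.single i 1) := by
  refine lt_of_le_of_ne (hg.nonneg _) fun h => ?_
  have := congrFun ((hg.eq_zero_iff _).1 h.symm) i
  simp at this

theorem abs_apply_le (x : Fin q → ℝ) (i : Fin q) : |x i| ≤ g x / g (Pi.single i 1) := by
  rw [le_div_iff₀ (hg.pos_single i), ← hg.smul]
  have h : x i • (Pi.single i 1 : Fin q → ℝ) = fun j => if j = i then x j else 0 := by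
    funext j
    by_cases h : j = i
    · subst h; simp
    · simp [h]
  rw [h]
  exact hg.restrict_le (fun j => j = i) x

/-- A supporting functional of a symmetric gauge. -/
theorem exists_support (x : Fin q → ℝ) : ∃ y, x ⬝ᵥ y = g x ∧ ∀ z, z ⬝ᵥ y ≤ g z := by
  by_cases hx : x = 0
  · refine ⟨0, ?_, fun z => ?_⟩
    · simp [hx, hg.zero]
    · simpa using hg.nonneg z
  -- Hahn–Banach: extend `c • x ↦ c * g x` from the line through `x`, dominated by `g`.
  obtain ⟨φ, h1, h2⟩ := exists_extension_of_le_sublinear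
    (LinearPMap.mkSpanSingleton (K := ℝ) x (g x) hx) g
    (fun c hc z => by rw [hg.smul, abs_of_pos hc]) hg.add_le (by
      rintro ⟨z, hz⟩
      obtain ⟨c, rfl⟩ := Submodule.mem_span_singleton.1 hz
      rw [LinearPMap.mkSpanSingleton'_apply, hg.smul, smul_eq_mul]
      exact mul_le_mul_of_nonneg_right (le_abs_self c) (hg.nonneg x))
  have hφ : ∀ z, z ⬝ᵥ (fun i => φ (Pi.single i 1)) = φ z := by
    intro z
    rw [← LinearMap.sum_single_apply (φ := fun _ : Fin q => ℝ) z]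
    simp only [map_sum]
    rw [LinearMap.sum_single_apply]
    refine Finset.sum_congr rfl fun i _ => ?_
    rw [← smul_eq_mul, ← map_smul]
    congr 1
    ext j
    by_cases h : j = i
    · subst h; simp
    · simp [h]
  refine ⟨fun i => φ (Pi.single i 1), ?_, fun z => ?_⟩
  · rw [hφ]
    exact (h1 ⟨x, Submodule.mem_span_singleton_self x⟩).trans
      (LinearPMap.mkSpanSingleton_apply ℝ ℝ hx (g x))
  · rw [hφ]; exact h2 z

end IsSymmetricGauge


/-! ### Dual norms of unitarily invariant functions -/

theorem sigmaVec_zero : sigmaVec (0 : Matrix (Fin n) (Fin m) ℝ) = 0 := by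
  funext i
  simp [sigmaVec, sigma]

theorem eq_zero_of_sigmaVec_eq_zero {X : Matrix (Fin n) (Fin m) ℝ} (h : sigmaVec X = 0) :
    X = 0 := by
  obtain ⟨u, v, h'⟩ := exists_isSVD X
  rw [h'.eq_expand, h]
  simp [expand]

theorem exists_expand_smul (c : ℝ) (X : Matrix (Fin n) (Fin m) ℝ) : ∃ u v, Orthonormal ℝ u ∧
    Orthonormal ℝ v ∧ X = expand u v (sigmaVec X) ∧ c • X = expand u v (c • sigmaVec X) := by
  obtain ⟨u, v, h⟩ := exists_isSVD X
  exact ⟨u, v, h.1, h.2, h.eq_expand, by rw [expand_smul, ← h.eq_expand]⟩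

theorem sigmaVec_smul (c : ℝ) (X : Matrix (Fin n) (Fin m) ℝ) :
    sigmaVec (c • X) = |c| • sigmaVec X := by
  obtain ⟨u, v, hu, hv, _, h⟩ := exists_expand_smul c X
  rw [h]
  refine sigmaVec_expand_abs_perm hu hv (fun i j hij => mul_le_mul_of_nonneg_left (sigmaVec_antitone X hij) (abs_nonneg c))
    (fun i => mul_nonneg (abs_nonneg c) (sigmaVec_nonneg X i)) 1 fun i => ?_
  simp [abs_mul, abs_of_nonneg (sigmaVec_nonneg X i)]

section dualNorm
variable {N : Matrix (Fin n) (Fin m) ℝ → ℝ}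

/-- A real `sSup` is meaningful only on bounded sets; a bound `C` for singular values on the unit
ball supplies this through the trace inequality. -/
theorem bddAbove_dualNorm {C : Fin (min n m) → ℝ} (hC : ∀ X, N X ≤ 1 → ∀ i, sigmaVec X i ≤ C i)
    (M : Matrix (Fin n) (Fin m) ℝ) :
    BddAbove {t : ℝ | ∃ X : Matrix (Fin n) (Fin m) ℝ, N X ≤ 1 ∧ t = matInner M X} := by
  refine ⟨sigmaVec M ⬝ᵥ C, ?_⟩
  rintro _ ⟨X, hX, rfl⟩
  exact (matInner_le_sigmaVec M X).trans
    (Finset.sum_le_sum fun i _ => mul_le_mul_of_nonneg_left (hC X hX i) (sigmaVec_nonneg M i))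

variable {C : Fin (min n m) → ℝ} (hC : ∀ X, N X ≤ 1 → ∀ i, sigmaVec X i ≤ C i)
include hC

theorem matInner_le_dualNorm {M X : Matrix (Fin n) (Fin m) ℝ} (hX : N X ≤ 1) :
    matInner M X ≤ dualNorm N M :=
  le_csSup (bddAbove_dualNorm hC M) ⟨X, hX, rfl⟩

omit hC in
theorem dualNorm_le (h0 : N 0 ≤ 1) {M : Matrix (Fin n) (Fin m) ℝ} {c : ℝ}
    (h : ∀ X, N X ≤ 1 → matInner M X ≤ c) : dualNorm N M ≤ c :=
  csSup_le ⟨_, 0, h0, rfl⟩ (by rintro _ ⟨X, hX, rfl⟩; exact h X hX)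

/-- A test matrix for `M` can be rotated into the singular vectors of `M'` without changing `N`, and
there its pairing is the largest possible. -/
theorem dualNorm_congr (h0 : N 0 ≤ 1) (hN : ∀ X Y, sigmaVec X = sigmaVec Y → N X = N Y)
    {M M' : Matrix (Fin n) (Fin m) ℝ} (h : sigmaVec M = sigmaVec M') :
    dualNorm N M = dualNorm N M' := by
  have key : ∀ M M' : Matrix (Fin n) (Fin m) ℝ, sigmaVec M = sigmaVec M' →
      dualNorm N M ≤ dualNorm N M' := by
    intro M M' h
    refine dualNorm_le h0 fun X hX => ?_
    obtain ⟨u, v, hM⟩ := exists_isSVD M'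
    have h1 := matInner_le_sigmaVec M X
    rw [h, ← matInner_expand_self hM.1 hM.2, ← hM.eq_expand] at h1
    refine h1.trans (matInner_le_dualNorm hC ?_)
    rwa [hN _ X]
    exact sigmaVec_expand hM.1 hM.2 (sigmaVec_antitone X) (sigmaVec_nonneg X)
  exact le_antisymm (key _ _ h) (key _ _ h.symm)

theorem dualNorm_nonneg (h0 : N 0 ≤ 1) (M : Matrix (Fin n) (Fin m) ℝ) : 0 ≤ dualNorm N M := by
  have := matInner_le_dualNorm hC (M := M) h0
  rwa [show matInner M 0 = 0 by simp [matInner]] at this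

theorem dualNorm_add_le (h0 : N 0 ≤ 1) (A B : Matrix (Fin n) (Fin m) ℝ) :
    dualNorm N (A + B) ≤ dualNorm N A + dualNorm N B := by
  refine dualNorm_le h0 fun X hX => ?_
  rw [matInner_add_left]
  exact add_le_add (matInner_le_dualNorm hC hX) (matInner_le_dualNorm hC hX)

theorem dualNorm_smul_le (h0 : N 0 ≤ 1) (hN : ∀ X Y, sigmaVec X = sigmaVec Y → N X = N Y) (c : ℝ)
    (A : Matrix (Fin n) (Fin m) ℝ) : dualNorm N (c • A) ≤ |c| * dualNorm N A := by
  refine dualNorm_le h0 fun X hX => ?_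
  rw [matInner_smul_left]
  rcases abs_cases c with ⟨h, hc⟩ | ⟨h, hc⟩
  · rw [h]
    exact mul_le_mul_of_nonneg_left (matInner_le_dualNorm hC hX) hc
  -- A negative sign moves onto the test matrix, whose singular values ignore it.
  · rw [h, show c * matInner A X = -c * matInner A ((-1 : ℝ) • X) by
      rw [matInner_smul_right]; ring]
    refine mul_le_mul_of_nonneg_left (matInner_le_dualNorm hC ?_) (by linarith)
    rwa [hN _ X]
    rw [sigmaVec_smul]; simp

end dualNorm

/-! ### Gauge norms and their dual gauges -/

section gauge
variable {g : (Fin (min n m) → ℝ) → ℝ} (hg : IsSymmetricGauge g)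
include hg

theorem gaugeNorm_expand {u v} (hu : Orthonormal ℝ u) (hv : Orthonormal ℝ v)
    (x : Fin (min n m) → ℝ) : gaugeNorm g (expand u v x : Matrix (Fin n) (Fin m) ℝ) = g x := by
  obtain ⟨τ, _, h⟩ := exists_sigmaVec_expand hu hv x
  rw [gaugeNorm, h]
  exact (hg.congr_abs_perm τ fun i => by simp).symm

theorem gaugeNorm_zero : gaugeNorm g (0 : Matrix (Fin n) (Fin m) ℝ) = 0 := by
  rw [gaugeNorm, sigmaVec_zero, hg.zero]

theorem sigmaVec_le_of_gaugeNorm_le (X : Matrix (Fin n) (Fin m) ℝ) (hX : gaugeNorm g X ≤ 1) (i) :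
    sigmaVec X i ≤ 1 / g (Pi.single i 1) :=
  (le_abs_self _).trans ((hg.abs_apply_le (sigmaVec X) i).trans
    (div_le_div_of_nonneg_right hX (hg.pos_single i).le))

theorem dualGauge_nonneg (y : Fin (min n m) → ℝ) : 0 ≤ dualGauge g y :=
  dualNorm_nonneg (sigmaVec_le_of_gaugeNorm_le hg) ((gaugeNorm_zero hg).trans_le zero_le_one) _

/-- The generalized Cauchy–Schwarz inequality for a gauge and its dual. -/
theorem dotProduct_le_mul_dualGauge (x y : Fin (min n m) → ℝ) : x ⬝ᵥ y ≤ g x * dualGauge g y := by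
  obtain ⟨u, v, hu, hv, hD⟩ := exists_rectDiag_eq_expand (n := n) (m := m)
  rcases (hg.nonneg x).eq_or_lt with h | h
  · rw [(hg.eq_zero_iff x).1 h.symm, hg.zero]; simp
  · have h1 : gaugeNorm g (expand u v ((g x)⁻¹ • x)) ≤ 1 := by
      rw [gaugeNorm_expand hg hu hv, hg.smul, abs_of_pos (inv_pos.2 h), inv_mul_cancel₀ h.ne']
    have h2 := matInner_le_dualNorm (sigmaVec_le_of_gaugeNorm_le hg) (M := rectDiag y) h1
    rw [hD, matInner_expand_self hu hv, dotProduct_smul, dotProduct_comm, smul_eq_mul,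
      inv_mul_le_iff₀ h, ← hD] at h2
    exact h2

/-- A test matrix acts at most through its singular values; giving these the order and signs of `y`
yields a vector of the same gauge, so vector tests suffice. -/
theorem dualGauge_le {y : Fin (min n m) → ℝ} {c : ℝ} (h : ∀ x, g x ≤ 1 → x ⬝ᵥ y ≤ c) :
    dualGauge g y ≤ c := by
  obtain ⟨u, v, hu, hv, hD⟩ := exists_rectDiag_eq_expand (n := n) (m := m)
  refine dualNorm_le ((gaugeNorm_zero hg).trans_le zero_le_one) fun X hX => ?_
  refine (matInner_le_sigmaVec _ X).trans ?_
  obtain ⟨τ, _, hτ⟩ := exists_sigmaVec_expand hu hv y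
  rw [hD, hτ]
  have hε : ∀ j, |y j| = (if 0 ≤ y j then 1 else -1) * y j := fun j => by
    split_ifs with h
    · rw [abs_of_nonneg h, one_mul]
    · rw [abs_of_neg (not_le.1 h)]; ring
  have hx := h (fun j => (if 0 ≤ y j then 1 else -1) * sigmaVec X (τ.symm j)) (by
    rw [hg.congr_abs_perm (y := sigmaVec X) τ]
    · exact hX
    · intro i
      simp only [Equiv.symm_apply_apply]
      split_ifs <;> simp)
  refine le_of_eq_of_le ?_ hx
  rw [dotProduct, dotProduct, ← Equiv.sum_comp τ fun j => _ * y j]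
  refine Finset.sum_congr rfl fun i _ => ?_
  rw [hε, Equiv.symm_apply_apply]
  ring

theorem dualGauge_sigmaVec_expand {u v} (hu : Orthonormal ℝ u) (hv : Orthonormal ℝ v)
    (y : Fin (min n m) → ℝ) :
    dualGauge g (sigmaVec (expand u v y : Matrix (Fin n) (Fin m) ℝ)) = dualGauge g y := by
  obtain ⟨u', v', hu', hv', hD⟩ := exists_rectDiag_eq_expand (n := n) (m := m)
  obtain ⟨τ, ha, hτ⟩ := exists_sigmaVec_expand hu hv y
  refine dualNorm_congr (sigmaVec_le_of_gaugeNorm_le hg)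
    ((gaugeNorm_zero hg).trans_le zero_le_one) (fun X Y h => by rw [gaugeNorm, h, gaugeNorm]) ?_
  rw [hD, hD, hτ, sigmaVec_expand hu' hv' ha fun i => abs_nonneg _,
    sigmaVec_expand_abs_perm hu' hv' ha (fun i => abs_nonneg _) τ fun i => rfl]

theorem dualGauge_trunc_le (r : ℕ) (y : Fin (min n m) → ℝ) :
    dualGauge g (trunc r y) ≤ dualGauge g y := by
  refine dualGauge_le hg fun x hx => ?_
  rw [← trunc_dotProduct]
  refine (dotProduct_le_mul_dualGauge hg _ y).trans ?_
  exact mul_le_of_le_one_left (dualGauge_nonneg hg y) ((hg.trunc_le r x).trans hx)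

theorem dualGauge_smul_le (c : ℝ) (hc : 0 ≤ c) (y : Fin (min n m) → ℝ) :
    dualGauge g (c • y) ≤ c * dualGauge g y := by
  refine dualGauge_le hg fun x hx => ?_
  rw [dotProduct_smul, smul_eq_mul]
  refine mul_le_mul_of_nonneg_left ((dotProduct_le_mul_dualGauge hg x y).trans ?_) hc
  exact mul_le_of_le_one_left (dualGauge_nonneg hg y) hx

/-- A functional supporting `g` at the singular values of `A + B` becomes a matrix that pairs
exactly with `A + B` and is bounded by the norm on each summand. -/
theorem gaugeNorm_add_le (A B : Matrix (Fin n) (Fin m) ℝ) :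
    gaugeNorm g (A + B) ≤ gaugeNorm g A + gaugeNorm g B := by
  obtain ⟨u, v, h⟩ := exists_isSVD (A + B)
  obtain ⟨y, hy, hy'⟩ := hg.exists_support (sigmaVec (A + B))
  have hd : dualGauge g y ≤ 1 := dualGauge_le hg fun x hx => (hy' x).trans hx
  have key : ∀ M : Matrix (Fin n) (Fin m) ℝ, matInner M (expand u v y) ≤ gaugeNorm g M := by
    intro M
    refine (matInner_le_sigmaVec _ _).trans ((dotProduct_le_mul_dualGauge hg _ _).trans ?_)
    rw [dualGauge_sigmaVec_expand hg h.1 h.2]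
    exact mul_le_of_le_one_right (hg.nonneg _) hd
  have h1 : gaugeNorm g (A + B) = matInner (A + B) (expand u v y) := by
    conv_rhs => rw [h.eq_expand, matInner_expand_self h.1 h.2, hy]
    rfl
  rw [h1, matInner_add_left]
  exact add_le_add (key A) (key B)

/-- The unitarily invariant norm of a symmetric gauge, as a seminorm. -/
def gaugeSeminorm : Seminorm ℝ (Matrix (Fin n) (Fin m) ℝ) :=
  Seminorm.of (gaugeNorm g) (gaugeNorm_add_le hg) fun c X => by
    rw [gaugeNorm, sigmaVec_smul, hg.smul, abs_abs]; rfl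

/-! ### The low-rank inducing norm -/

section lowRank
variable {r : ℕ}

theorem truncDualNorm_zero : truncDualNorm g r (0 : Matrix (Fin n) (Fin m) ℝ) ≤ 1 := by
  refine dualGauge_le hg fun x _ => ?_
  simp [sigmaVec_zero, dotProduct]

omit hg in
theorem truncDualNorm_eq (X : Matrix (Fin n) (Fin m) ℝ) :
    truncDualNorm g r X = dualGauge g (trunc r (sigmaVec X)) := rfl

omit hg in
theorem truncDualNorm_congr (X Y : Matrix (Fin n) (Fin m) ℝ) (h : sigmaVec X = sigmaVec Y) :
    truncDualNorm g r X = truncDualNorm g r Y := by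
  rw [truncDualNorm, h, truncDualNorm]

variable (hr1 : 1 ≤ r) (hrq : r ≤ min n m)
include hr1 hrq

/-- Since `r ≥ 1`, truncation keeps the largest singular value, and pairing with the first unit
vector controls it. -/
theorem sigmaVec_le_mul_truncDualNorm (X : Matrix (Fin n) (Fin m) ℝ) (i) :
    sigmaVec X i ≤ g (Pi.single ⟨0, by omega⟩ 1) * truncDualNorm g r X := by
  have h := dotProduct_le_mul_dualGauge hg (Pi.single ⟨0, by omega⟩ 1) (trunc r (sigmaVec X))
  rw [single_dotProduct, one_mul, ← truncDualNorm_eq, trunc, if_pos (show 0 < r from hr1)] at h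
  exact (sigmaVec_antitone X (Fin.le_def.2 (Nat.zero_le _))).trans h

theorem sigmaVec_le_of_truncDualNorm_le (X : Matrix (Fin n) (Fin m) ℝ)
    (hX : truncDualNorm g r X ≤ 1) (i) : sigmaVec X i ≤ g (Pi.single ⟨0, by omega⟩ 1) :=
  (sigmaVec_le_mul_truncDualNorm hg hr1 hrq X i).trans (mul_le_of_le_one_right (hg.nonneg _) hX)

theorem lowRankNorm_congr {M M' : Matrix (Fin n) (Fin m) ℝ} (h : sigmaVec M = sigmaVec M') :
    lowRankNorm g r M = lowRankNorm g r M' :=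
  dualNorm_congr (sigmaVec_le_of_truncDualNorm_le hg hr1 hrq) (truncDualNorm_zero hg)
    truncDualNorm_congr h

theorem matInner_le_lowRankNorm_mul (M X : Matrix (Fin n) (Fin m) ℝ) :
    matInner M X ≤ lowRankNorm g r M * truncDualNorm g r X := by
  rcases (dualGauge_nonneg hg (trunc r (sigmaVec X))).eq_or_lt with h | h
  · have h0 : X = 0 := by
      refine eq_zero_of_sigmaVec_eq_zero (funext fun i => le_antisymm ?_ (sigmaVec_nonneg X i))
      have := sigmaVec_le_mul_truncDualNorm hg hr1 hrq X i
      rwa [truncDualNorm_eq, ← h, mul_zero] at this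
    rw [truncDualNorm_eq, ← h, h0]
    simp [matInner]
  · rw [← truncDualNorm_eq] at h
    have h1 : truncDualNorm g r ((truncDualNorm g r X)⁻¹ • X) ≤ 1 := by
      rw [truncDualNorm_eq ((truncDualNorm g r X)⁻¹ • X), sigmaVec_smul, abs_of_pos (inv_pos.2 h)]
      have e : trunc r ((truncDualNorm g r X)⁻¹ • sigmaVec X) =
          (truncDualNorm g r X)⁻¹ • trunc r (sigmaVec X) := by
        funext i
        simp only [trunc, Pi.smul_apply, smul_eq_mul]
        split_ifs <;> simp
      rw [e]
      refine (dualGauge_smul_le hg _ (inv_pos.2 h).le _).trans ?_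
      rw [← truncDualNorm_eq, inv_mul_cancel₀ h.ne']
    have h2 := matInner_le_dualNorm (sigmaVec_le_of_truncDualNorm_le hg hr1 hrq) (M := M) h1
    rw [matInner_smul_right, inv_mul_le_iff₀ h] at h2
    rw [mul_comm]
    exact h2

/-- The low-rank inducing norm as a seminorm. -/
def lowRankSeminorm : Seminorm ℝ (Matrix (Fin n) (Fin m) ℝ) :=
  Seminorm.ofSMulLE (lowRankNorm g r)
    (le_antisymm (dualNorm_le (truncDualNorm_zero hg) fun X _ => by simp [matInner])
      (dualNorm_nonneg (sigmaVec_le_of_truncDualNorm_le hg hr1 hrq) (truncDualNorm_zero hg) 0))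
    (dualNorm_add_le (sigmaVec_le_of_truncDualNorm_le hg hr1 hrq) (truncDualNorm_zero hg))
    (dualNorm_smul_le (sigmaVec_le_of_truncDualNorm_le hg hr1 hrq) (truncDualNorm_zero hg)
      truncDualNorm_congr)

/-- The matrix of a functional supporting `g` at `sigmaVec M` remains an admissible test, because
truncation does not increase the dual gauge. -/
theorem gaugeNorm_le_lowRankNorm (M : Matrix (Fin n) (Fin m) ℝ) :
    gaugeNorm g M ≤ lowRankNorm g r M := by
  obtain ⟨u, v, h⟩ := exists_isSVD M
  obtain ⟨y, hy, hy'⟩ := hg.exists_support (sigmaVec M)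
  have hd : dualGauge g y ≤ 1 := dualGauge_le hg fun x hx => (hy' x).trans hx
  have h1 : truncDualNorm g r (expand u v y : Matrix (Fin n) (Fin m) ℝ) ≤ 1 := by
    rw [truncDualNorm_eq]
    refine (dualGauge_trunc_le hg _ _).trans ?_
    rwa [dualGauge_sigmaVec_expand hg h.1 h.2]
  have h2 := matInner_le_dualNorm (sigmaVec_le_of_truncDualNorm_le hg hr1 hrq) (M := M) h1
  have h3 : matInner M (expand u v y) = gaugeNorm g M := by
    conv_lhs => rw [h.eq_expand, matInner_expand_self h.1 h.2, hy]
    rfl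
  rwa [h3] at h2

/-- Against a matrix of rank at most `r` only the first `r` singular values of a test matrix matter,
and those are what the truncated dual norm measures. -/
theorem lowRankNorm_eq_gaugeNorm {M : Matrix (Fin n) (Fin m) ℝ} (hM : M.rank ≤ r) :
    lowRankNorm g r M = gaugeNorm g M := by
  refine le_antisymm (dualNorm_le (truncDualNorm_zero hg) fun X hX => ?_)
    (gaugeNorm_le_lowRankNorm hg hr1 hrq M)
  refine (matInner_le_sigmaVec M X).trans ?_
  rw [← trunc_eq_self r ((rank_le_iff_sigmaVec M r).1 hM), trunc_dotProduct]
  exact (dotProduct_le_mul_dualGauge hg _ _).trans (mul_le_of_le_one_right (hg.nonneg _) hX)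

end lowRank
end gauge

/-! ### Comparison of proximal problems -/

theorem frobNorm_sub_sq (X Y : Matrix (Fin n) (Fin m) ℝ) : frobNorm (X - Y) ^ 2 =
    frobNorm X ^ 2 - 2 * matInner X Y + frobNorm Y ^ 2 := by
  simp only [frobNorm_sq, matInner_sub_left, matInner_sub_right, matInner_comm Y X]
  ring

theorem continuous_matInner_self_sub (Z : Matrix (Fin n) (Fin m) ℝ) :
    Continuous fun M : Matrix (Fin n) (Fin m) ℝ => matInner (M - Z) (M - Z) := by
  unfold matInner
  fun_prop

theorem abs_sub_apply_le_frobNorm (X : Matrix (Fin n) (Fin m) ℝ) (i j) : |X i j| ≤ frobNorm X := by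
  refine Real.abs_le_sqrt ?_
  rw [matInner_eq_sum, sq]
  exact (Finset.single_le_sum (f := fun j => X i j * X i j)
    (fun j _ => mul_self_nonneg (X i j)) (Finset.mem_univ j)).trans
    (Finset.single_le_sum (f := fun i => ∑ j, X i j * X i j)
      (fun i _ => Finset.sum_nonneg fun j _ => mul_self_nonneg (X i j)) (Finset.mem_univ i))

theorem seminorm_continuous (p : Seminorm ℝ (Matrix (Fin n) (Fin m) ℝ)) :
    Continuous p := by
  -- On this normed finite-dimensional space, convexity alone gives continuity.
  let q : Seminorm ℝ (Fin n → Fin m → ℝ) := p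
  have h := q.convexOn.continuousOn isOpen_univ
  exact continuousOn_univ.1 h

theorem frobNorm_le_of_mem_prox {φ : Matrix (Fin n) (Fin m) ℝ → EReal}
    {Z M M' : Matrix (Fin n) (Fin m) ℝ} (hM : M ∈ prox φ Z) (hb : φ M ≠ ⊥) (ht : φ M ≠ ⊤)
    (h : φ M' ≤ φ M) : frobNorm (M - Z) ^ 2 ≤ frobNorm (M' - Z) ^ 2 := by
  have h1 := (hM M').trans (add_le_add_left h _)
  lift φ M to ℝ using ⟨ht, hb⟩ with a
  norm_cast at h1
  linarith

/-- If `ψ ≥ φ` with equality at the unique minimizer for `φ`, this is the unique minimizer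
for `ψ`. -/
theorem prox_eq_singleton_of_le {φ ψ : Matrix (Fin n) (Fin m) ℝ → EReal}
    {Z X : Matrix (Fin n) (Fin m) ℝ} (h : prox φ Z = {X}) (hle : ∀ M, φ M ≤ ψ M)
    (heq : ψ X = φ X) : prox ψ Z = {X} := by
  have hX : X ∈ prox φ Z := by rw [h]; rfl
  refine Set.eq_singleton_iff_unique_mem.2 ⟨fun N => ?_, fun Y hY => ?_⟩
  · rw [heq]
    exact (hX N).trans (add_le_add_left (hle N) _)
  · have : Y ∈ prox φ Z := fun N =>
      ((add_le_add_left (hle Y) _).trans (hY X)).trans (by rw [heq]; exact hX N)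
    rwa [h] at this

/-! ### Existence, uniqueness and optimality for convex proximal problems -/

section k
variable {k : ℝ≥0 → EReal} (hk : IsProperClosedConvexIncreasing k)
include hk

theorem IsProperClosedConvexIncreasing.zero_ne_top : k 0 ≠ ⊤ := by
  obtain ⟨x, hx⟩ := hk.proper
  exact ((hk.monotone zero_le).trans_lt (lt_top_iff_ne_top.2 hx)).ne

theorem IsProperClosedConvexIncreasing.lowerSemicontinuous : LowerSemicontinuous k := by
  rw [lowerSemicontinuous_iff_isClosed_preimage]
  intro α
  induction α using EReal.rec with
  | bot =>
    have : k ⁻¹' Set.Iic ⊥ = ∅ := by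
      ext x; simp [hk.ne_bot x]
    rw [this]; exact isClosed_empty
  | coe α => exact hk.closed α
  | top => simp

variable {γ : ℝ} (hγ : 0 < γ)
include hγ

theorem mul_compNorm_ne_bot (N : Matrix (Fin n) (Fin m) ℝ → ℝ) (M) :
    (γ : EReal) * compNorm k N M ≠ ⊥ := by
  have h := hk.ne_bot (N M).toNNReal
  unfold compNorm
  generalize k (N M).toNNReal = y at h
  induction y using EReal.rec with
  | bot => exact absurd rfl h
  | coe a => rw [← EReal.coe_mul]; exact EReal.coe_ne_bot _
  | top => rw [EReal.coe_mul_top_of_pos hγ]; simp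

omit hk in
theorem mul_compNorm_eq_top {N : Matrix (Fin n) (Fin m) ℝ → ℝ} {M}
    (h : k (N M).toNNReal = ⊤) : (γ : EReal) * compNorm k N M = ⊤ := by
  rw [compNorm, h, EReal.coe_mul_top_of_pos hγ]

theorem mul_compNorm_le {N N' : Matrix (Fin n) (Fin m) ℝ → ℝ} {M M'} (h : N M ≤ N' M') :
    (γ : EReal) * compNorm k N M ≤ (γ : EReal) * compNorm k N' M' :=
  mul_le_mul_of_nonneg_left (hk.monotone (Real.toNNReal_mono h)) (by exact_mod_cast hγ.le)

variable (p : Seminorm ℝ (Matrix (Fin n) (Fin m) ℝ))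

/-- Comparison with the zero matrix, where the objective is finite, rules out the value `⊤`. -/
theorem exists_coe_of_mem_prox {Z M : Matrix (Fin n) (Fin m) ℝ}
    (hM : M ∈ prox (fun M => (γ : EReal) * compNorm k p M) Z) :
    ∃ a : ℝ, k (p M).toNNReal = a := by
  have h0 := hk.zero_ne_top
  have h0' := hk.ne_bot 0
  refine ⟨(k (p M).toNNReal).toReal, (EReal.coe_toReal (fun h => ?_) (hk.ne_bot _)).symm⟩
  have h1 := hM 0
  dsimp only at h1
  rw [mul_compNorm_eq_top hγ h, EReal.top_add_coe, top_le_iff, compNorm, map_zero,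
    Real.toNNReal_zero] at h1
  lift k 0 to ℝ using ⟨h0, h0'⟩ with a
  exact EReal.coe_ne_top _ (by exact_mod_cast h1)

theorem prox_seminorm_nonempty (Z : Matrix (Fin n) (Fin m) ℝ) :
    (prox (fun M => (γ : EReal) * compNorm k p M) Z).Nonempty := by
  obtain ⟨k0, hk0⟩ : ∃ a : ℝ, k 0 = a :=
    ⟨_, (EReal.coe_toReal hk.zero_ne_top (hk.ne_bot 0)).symm⟩
  -- Passing to the closed epigraph replaces the extended-real objective by the continuous real
  -- function `h`.
  let E : Set (Matrix (Fin n) (Fin m) ℝ × ℝ) := {x | k (p x.1).toNNReal ≤ (x.2 : EReal)}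
  have hE : IsClosed E := by
    have h1 := hk.lowerSemicontinuous.isClosed_epigraph
    have hp := seminorm_continuous p
    exact h1.preimage (f := fun x : Matrix (Fin n) (Fin m) ℝ × ℝ =>
      ((p x.1).toNNReal, (x.2 : EReal)))
      (((continuous_real_toNNReal.comp hp).comp continuous_fst).prodMk
        (continuous_coe_real_ereal.comp continuous_snd))
  let h : Matrix (Fin n) (Fin m) ℝ × ℝ → ℝ := fun x =>
    γ * x.2 + 1 / 2 * matInner (x.1 - Z) (x.1 - Z)
  have hc : Continuous h := (continuous_const.mul continuous_snd).add
    (continuous_const.mul ((continuous_matInner_self_sub Z).comp continuous_fst))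
  have hE0 : ((0, k0) : Matrix (Fin n) (Fin m) ℝ × ℝ) ∈ E := by
    change k (p 0).toNNReal ≤ _
    rw [map_zero, Real.toNNReal_zero, hk0]
  have hk0le : ∀ x ∈ E, k0 ≤ x.2 := by
    intro x hx
    have := (hk.monotone (zero_le (a := (p x.1).toNNReal))).trans hx
    rw [hk0] at this
    exact_mod_cast this
  let S := E ∩ {x | h x ≤ h (0, k0)}
  -- On `S` the height is at least `k0`, so the distance to `Z` is at most that of the zero matrix;
  -- the height is in turn at most `h (0, k0) / γ`.
  have hS : IsCompact S := by
    let K : Set (Matrix (Fin n) (Fin m) ℝ) := Set.univ.pi fun i => Set.univ.pi fun j =>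
      Set.Icc (Z i j - frobNorm Z) (Z i j + frobNorm Z)
    have hK : IsCompact K := isCompact_univ_pi fun i => isCompact_univ_pi fun j => isCompact_Icc
    refine (hK.prod (isCompact_Icc (a := k0) (b := h (0, k0) / γ))).of_isClosed_subset
      (hE.inter (isClosed_le hc continuous_const)) ?_
    rintro ⟨M, s⟩ ⟨hx, hx'⟩
    have h1 : k0 ≤ s := hk0le _ hx
    have h2 : γ * s + 1 / 2 * matInner (M - Z) (M - Z) ≤
      γ * k0 + 1 / 2 * matInner (0 - Z) (0 - Z) := hx'
    have h3 := mul_le_mul_of_nonneg_left h1 hγ.le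
    refine ⟨?_, h1, ?_⟩
    · have h4 : frobNorm (M - Z) ≤ frobNorm Z := by
        refine Real.sqrt_le_sqrt ?_
        have : matInner (0 - Z) (0 - Z) = matInner Z Z := by
          rw [zero_sub, ← neg_one_smul ℝ, matInner_smul_left, matInner_smul_right]; ring
        linarith
      intro i _ j _
      have := abs_le.1 ((abs_sub_apply_le_frobNorm (M - Z) i j).trans h4)
      rw [Matrix.sub_apply] at this
      constructor <;> linarith
    · rw [le_div_iff₀ hγ]
      have := matInner_self_nonneg (M - Z)
      change s * γ ≤ γ * k0 + 1 / 2 * matInner (0 - Z) (0 - Z)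
      linarith
  obtain ⟨⟨M, s⟩, ⟨hM, hMs⟩, hmin⟩ := hS.exists_isMinOn ⟨_, hE0, le_refl (h (0, k0))⟩
    hc.continuousOn
  refine ⟨M, fun N => ?_⟩
  have hM1 : (γ : EReal) * compNorm k p M + ((1 / 2 * frobNorm (M - Z) ^ 2 : ℝ) : EReal) ≤
      ((h (M, s) : ℝ) : EReal) := by
    rw [frobNorm_sq, EReal.coe_add, EReal.coe_mul γ s]
    exact add_le_add_left (mul_le_mul_of_nonneg_left hM (by exact_mod_cast hγ.le)) _
  refine hM1.trans ?_
  by_cases hN : k (p N).toNNReal = ⊤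
  · dsimp only
    rw [mul_compNorm_eq_top hγ hN, EReal.top_add_coe]
    exact le_top
  · obtain ⟨b, hb⟩ : ∃ b : ℝ, k (p N).toNNReal = b :=
      ⟨_, (EReal.coe_toReal hN (hk.ne_bot _)).symm⟩
    have hNE : (N, b) ∈ E := hb.le
    have : h (M, s) ≤ h (N, b) := by
      by_cases hle : h (N, b) ≤ h (0, k0)
      · exact hmin ⟨hNE, hle⟩
      · exact hMs.trans (not_le.1 hle).le
    dsimp only
    rw [compNorm, hb, frobNorm_sq]
    exact_mod_cast this

theorem prox_seminorm_subsingleton (Z : Matrix (Fin n) (Fin m) ℝ) :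
    (prox (fun M => (γ : EReal) * compNorm k p M) Z).Subsingleton := by
  intro A hA B hB
  obtain ⟨a, ha⟩ := exists_coe_of_mem_prox hk hγ p hA
  obtain ⟨b, hb⟩ := exists_coe_of_mem_prox hk hγ p hB
  have hAB := hA B
  have hBA := hB A
  set C : Matrix (Fin n) (Fin m) ℝ := (1 / 2 : ℝ) • A + (1 / 2 : ℝ) • B with hC
  have hpC : k (p C).toNNReal ≤ ((1 / 2 * a + 1 / 2 * b : ℝ) : EReal) := by
    have h1 : p C ≤ 1 / 2 * p A + 1 / 2 * p B := by
      refine (map_add_le_add p _ _).trans ?_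
      rw [map_smul_eq_mul, map_smul_eq_mul]
      norm_num
    have h2 : (p C).toNNReal ≤ (1 / 2) * (p A).toNNReal + (1 / 2) * (p B).toNNReal := by
      rw [← NNReal.coe_le_coe]
      push_cast
      rw [Real.coe_toNNReal _ (apply_nonneg p _), Real.coe_toNNReal _ (apply_nonneg p _),
        Real.coe_toNNReal _ (apply_nonneg p _)]
      exact h1
    have h3 := (hk.monotone h2).trans (hk.convex _ _ (1 / 2) (1 / 2) (by positivity)
      (by positivity) (add_halves 1))
    rw [ha, hb] at h3
    refine h3.trans_eq ?_
    push_cast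
    norm_num
  have hAC := (hA C).trans (add_le_add_left (mul_le_mul_of_nonneg_left hpC
    (by exact_mod_cast hγ.le)) _)
  dsimp only at hAB hBA hAC
  simp only [compNorm, ha, hb] at hAB hBA hAC
  norm_cast at hAB hBA hAC
  -- The parallelogram identity at the midpoint: its negative term must vanish, as the midpoint
  -- cannot improve on two minimizers.
  have hCZ : frobNorm (C - Z) ^ 2 = 1 / 2 * frobNorm (A - Z) ^ 2 + 1 / 2 * frobNorm (B - Z) ^ 2 -
      1 / 4 * frobNorm (A - B) ^ 2 := by
    simp only [hC, frobNorm_sq, matInner_sub_left, matInner_sub_right, matInner_add_left,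
      matInner_add_right, matInner_smul_left, matInner_smul_right, matInner_comm B A,
      matInner_comm Z A, matInner_comm Z B]
    ring
  have : matInner (A - B) (A - B) = 0 := by
    refine le_antisymm ?_ (matInner_self_nonneg _)
    rw [← frobNorm_sq]
    linarith
  exact sub_eq_zero.1 (matInner_self_eq_zero this)

theorem exists_prox_seminorm_eq_singleton (Z : Matrix (Fin n) (Fin m) ℝ) :
    ∃ M, prox (fun M => (γ : EReal) * compNorm k p M) Z = {M} := by
  obtain ⟨M, hM⟩ := prox_seminorm_nonempty hk hγ p Z
  exact ⟨M, (prox_seminorm_subsingleton hk hγ p Z).eq_singleton_of_mem hM⟩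

theorem frobNorm_le_of_seminorm_le {Z M M' : Matrix (Fin n) (Fin m) ℝ}
    (hM : M ∈ prox (fun M => (γ : EReal) * compNorm k p M) Z) (h : p M' ≤ p M) :
    frobNorm (M - Z) ^ 2 ≤ frobNorm (M' - Z) ^ 2 := by
  refine frobNorm_le_of_mem_prox hM (mul_compNorm_ne_bot hk hγ _ _) ?_ (mul_compNorm_le hk hγ h)
  obtain ⟨a, ha⟩ := exists_coe_of_mem_prox hk hγ p hM
  rw [compNorm, ha, ← EReal.coe_mul]
  exact EReal.coe_ne_top _

/-- The residual of a proximal point is a normal vector to the sublevel set of the seminorm. -/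
theorem matInner_sub_le_of_mem_prox {Z M M' : Matrix (Fin n) (Fin m) ℝ}
    (hM : M ∈ prox (fun M => (γ : EReal) * compNorm k p M) Z) (h : p M' ≤ p M) :
    matInner (Z - M) M' ≤ matInner (Z - M) M := by
  have key : ∀ t : ℝ, 0 < t → t ≤ 1 →
      2 * matInner (Z - M) (M' - M) ≤ t * matInner (M' - M) (M' - M) := by
    intro t ht ht1
    have h1 : p ((1 - t) • M + t • M') ≤ p M := by
      refine (map_add_le_add p _ _).trans ?_
      rw [map_smul_eq_mul, map_smul_eq_mul, Real.norm_of_nonneg ht.le,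
        Real.norm_of_nonneg (sub_nonneg.2 ht1)]
      nlinarith
    have h2 := frobNorm_le_of_seminorm_le hk hγ p hM h1
    have h3 : (1 - t) • M + t • M' - Z = (M - Z) + t • (M' - M) := by
      rw [sub_smul, one_smul, smul_sub]; abel
    have h4 : M - Z = (-1 : ℝ) • (Z - M) := by rw [neg_one_smul, neg_sub]
    rw [h3, frobNorm_sq, frobNorm_sq, matInner_add_left, matInner_add_right, matInner_add_right,
      matInner_comm (t • (M' - M)) (M - Z), matInner_smul_right, matInner_smul_right,
      matInner_smul_left, h4, matInner_smul_left _ (Z - M) (M' - M)] at h2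
    have h5 : 0 ≤ t * (t * matInner (M' - M) (M' - M) - 2 * matInner (Z - M) (M' - M)) := by
      linarith
    have := nonneg_of_mul_nonneg_right h5 ht
    linarith
  by_contra hcon
  have hA : 0 < matInner (Z - M) (M' - M) := by rw [matInner_sub_right]; linarith
  have hB := matInner_self_nonneg (M' - M)
  -- With `A`, `B` the pairings in `hA`, `hB`, this step satisfies `t * B ≤ A`, whereas `key`
  -- demands `2 * A ≤ t * B`.
  have h1 := key (min 1 (matInner (Z - M) (M' - M) / (matInner (M' - M) (M' - M) + 1)))
    (lt_min one_pos (by positivity)) (min_le_left _ _)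
  have h2 := mul_le_mul_of_nonneg_right (min_le_right 1
    (matInner (Z - M) (M' - M) / (matInner (M' - M) (M' - M) + 1))) hB
  have h3 : matInner (Z - M) (M' - M) / (matInner (M' - M) (M' - M) + 1) *
      matInner (M' - M) (M' - M) ≤ matInner (Z - M) (M' - M) := by
    rw [div_mul_eq_mul_div, div_le_iff₀ (by positivity)]
    nlinarith
  linarith

end k

/-! ### Alignment with the singular vectors of the given matrix -/

theorem rank_expand_le {q : ℕ} (u : Fin q → EuclideanSpace ℝ (Fin n))
    (v : Fin q → EuclideanSpace ℝ (Fin m)) (r : ℕ) (x : Fin q → ℝ) :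
    (expand u v (trunc r x)).rank ≤ r := by
  have h : expand u v (trunc r x) = (Matrix.of fun a i => u i a) *
      (Matrix.diagonal (trunc r x) * Matrix.of fun i b => v i b) := by
    ext a b
    simp only [expand, Matrix.sum_apply, Matrix.smul_apply, Matrix.vecMulVec_apply,
      Matrix.mul_apply (M := Matrix.of _), Matrix.diagonal_mul, Matrix.of_apply, smul_eq_mul]
    exact Finset.sum_congr rfl fun i _ => by ring
  rw [h]
  refine (Matrix.rank_mul_le_right _ _).trans ((Matrix.rank_mul_le_left _ _).trans ?_)
  rw [Matrix.rank_diagonal]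
  have hr : ∀ i : {i // trunc r x i ≠ 0}, (i : ℕ) < r := by
    rintro ⟨i, hi⟩
    by_contra h
    exact hi (if_neg h)
  have := Fintype.card_le_of_injective
    (fun i : {i // trunc r x i ≠ 0} => (⟨i, hr i⟩ : Fin r)) fun i j hij => by
      simpa [Fin.ext_iff, Subtype.ext_iff] using hij
  simpa using this

theorem matInner_self_eq_sigmaVec (M : Matrix (Fin n) (Fin m) ℝ) :
    matInner M M = sigmaVec M ⬝ᵥ sigmaVec M := by
  obtain ⟨u, v, h⟩ := exists_isSVD M
  conv_lhs => rw [h.eq_expand, matInner_expand_self h.1 h.2]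

/-- Replacing singular vectors of `M` by those of `Z` brings `M` closer to `Z`. -/
theorem frobNorm_expand_sigmaVec_sub_le {Z : Matrix (Fin n) (Fin m) ℝ} {u v} (h : IsSVD Z u v)
    (M : Matrix (Fin n) (Fin m) ℝ) :
    frobNorm (expand u v (sigmaVec M) - Z) ^ 2 ≤ frobNorm (M - Z) ^ 2 := by
  have h1 := matInner_le_sigmaVec M Z
  have h2 : matInner (expand u v (sigmaVec M)) Z = sigmaVec M ⬝ᵥ sigmaVec Z := by
    conv_lhs => rw [h.eq_expand, matInner_expand_self h.1 h.2]
  rw [frobNorm_sub_sq, frobNorm_sub_sq, h2, frobNorm_sq, matInner_expand_self h.1 h.2,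
    ← matInner_self_eq_sigmaVec, frobNorm_sq, frobNorm_sq]
  linarith

theorem mem_prox_of_le {φ : Matrix (Fin n) (Fin m) ℝ → EReal} {Z M M' : Matrix (Fin n) (Fin m) ℝ}
    (hM : M ∈ prox φ Z) (h : φ M' ≤ φ M) (hd : frobNorm (M' - Z) ^ 2 ≤ frobNorm (M - Z) ^ 2) :
    M' ∈ prox φ Z := fun N =>
  (add_le_add h (by exact_mod_cast mul_le_mul_of_nonneg_left hd (by norm_num))).trans (hM N)

/-- A proximal point of a spectral function shares its singular vectors with the given matrix. -/
theorem eq_expand_of_prox_eq_singleton {φ : Matrix (Fin n) (Fin m) ℝ → EReal}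
    (hφ : ∀ A B, sigmaVec A = sigmaVec B → φ A = φ B) {Z M : Matrix (Fin n) (Fin m) ℝ}
    (hM : prox φ Z = {M}) {u v} (h : IsSVD Z u v) : M = expand u v (sigmaVec M) := by
  have h1 : expand u v (sigmaVec M) ∈ prox φ Z :=
    mem_prox_of_le (by rw [hM]; rfl)
      (hφ _ M (sigmaVec_expand h.1 h.2 (sigmaVec_antitone M) (sigmaVec_nonneg M))).le
      (frobNorm_expand_sigmaVec_sub_le h M)
  rw [hM] at h1
  exact h1.symm

theorem frobNorm_expand_sub_sq {q : ℕ} {u : Fin q → EuclideanSpace ℝ (Fin n)}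
    {v : Fin q → EuclideanSpace ℝ (Fin m)} (hu : Orthonormal ℝ u) (hv : Orthonormal ℝ v)
    (x z : Fin q → ℝ) :
    frobNorm (expand u v x - expand u v z) ^ 2 = ∑ i, (x i - z i) ^ 2 := by
  rw [← expand_sub, frobNorm_sq, matInner_expand_self hu hv]
  exact Finset.sum_congr rfl fun i _ => by simp [sq]

/-- Pythagoras: a truncated candidate leaves the tail of `z` untouched, so this contribution is
constant. -/
theorem frobNorm_expand_trunc_sub_sq {q : ℕ} {u : Fin q → EuclideanSpace ℝ (Fin n)}
    {v : Fin q → EuclideanSpace ℝ (Fin m)} (hu : Orthonormal ℝ u) (hv : Orthonormal ℝ v) (r : ℕ)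
    (x z : Fin q → ℝ) : frobNorm (expand u v (trunc r x) - expand u v z) ^ 2 =
      frobNorm (expand u v (trunc r x) - expand u v (trunc r z)) ^ 2 +
        ∑ i, (z i - trunc r z i) ^ 2 := by
  rw [frobNorm_expand_sub_sq hu hv, frobNorm_expand_sub_sq hu hv, ← Finset.sum_add_distrib]
  refine Finset.sum_congr rfl fun i _ => ?_
  unfold trunc
  split_ifs <;> ring

/-! ### The rank constrained problem -/

section
variable {g : (Fin (min n m) → ℝ) → ℝ} (hg : IsSymmetricGauge g)
  {k : ℝ≥0 → EReal} (hk : IsProperClosedConvexIncreasing k)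
  {r : ℕ} {γ : ℝ} (hγ : 0 < γ)

theorem mul_rankConstrained_of_rank_le {M : Matrix (Fin n) (Fin m) ℝ} (hM : M.rank ≤ r) :
    (γ : EReal) * rankConstrained k g r M = (γ : EReal) * compNorm k (gaugeNorm g) M := by
  rw [rankConstrained, chi, if_pos (by exact hM), add_zero]

include hk hγ in
theorem mul_rankConstrained_of_not_rank_le {M : Matrix (Fin n) (Fin m) ℝ} (hM : ¬ M.rank ≤ r) :
    (γ : EReal) * rankConstrained k g r M = ⊤ := by
  rw [rankConstrained, chi, if_neg (by exact hM), compNorm, EReal.add_top_of_ne_bot (hk.ne_bot _),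
    EReal.coe_mul_top_of_pos hγ]

include hg hk hγ

theorem exists_prox_gaugeNorm (Z : Matrix (Fin n) (Fin m) ℝ) : ∃ M,
    prox (fun M => (γ : EReal) * compNorm k (gaugeNorm g) M) Z = {M} :=
  exists_prox_seminorm_eq_singleton hk hγ (gaugeSeminorm hg) Z

/-- The proximal point at a truncated matrix has the same support in the singular basis. -/
theorem prox_gaugeNorm_trunc {u v} (hu : Orthonormal ℝ u) (hv : Orthonormal ℝ v)
    {z : Fin (min n m) → ℝ} (hz : Antitone z) (hz0 : ∀ i, 0 ≤ z i)
    {X : Matrix (Fin n) (Fin m) ℝ}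
    (hX : prox (fun M => (γ : EReal) * compNorm k (gaugeNorm g) M) (expand u v (trunc r z)) = {X}) :
    X = expand u v (trunc r (sigmaVec X)) := by
  have h := eq_expand_of_prox_eq_singleton (fun A B h => by simp only [compNorm, gaugeNorm, h]) hX
    (isSVD_expand hu hv (trunc_antitone r hz hz0) (trunc_nonneg r hz0))
  have h1 : expand u v (trunc r (sigmaVec X)) ∈
      prox (fun M => (γ : EReal) * compNorm k (gaugeNorm g) M) (expand u v (trunc r z)) := by
    refine mem_prox_of_le (M := X) (by rw [hX]; rfl) (mul_compNorm_le hk hγ ?_) ?_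
    · rw [gaugeNorm_expand hg hu hv]
      exact hg.trunc_le r _
    · conv_rhs => rw [h]
      rw [frobNorm_expand_sub_sq hu hv, frobNorm_expand_sub_sq hu hv]
      refine Finset.sum_le_sum fun i _ => ?_
      unfold trunc
      split_ifs
      · exact le_rfl
      · rw [sub_zero, sq, mul_zero]; positivity
  rw [hX] at h1
  exact h1.symm

variable (hr1 : 1 ≤ r) (hrq : r ≤ min n m)

/-- The proximal point at a rank-`r` truncation solves the rank constrained problem. -/
theorem prox_gaugeNorm_mem_prox_rankConstrained {Z : Matrix (Fin n) (Fin m) ℝ} {u v}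
    (h : IsSVD Z u v) {X : Matrix (Fin n) (Fin m) ℝ}
    (hX : prox (fun M => (γ : EReal) * compNorm k (gaugeNorm g) M)
      (expand u v (trunc r (sigmaVec Z))) = {X}) :
    X ∈ prox (fun M => (γ : EReal) * rankConstrained k g r M) Z := by
  have hXe := prox_gaugeNorm_trunc hg hk hγ h.1 h.2 (sigmaVec_antitone Z) (sigmaVec_nonneg Z) hX
  have hXr : X.rank ≤ r := by rw [hXe]; exact rank_expand_le u v r _
  intro N
  dsimp only
  by_cases hN : N.rank ≤ r
  swap
  · rw [mul_rankConstrained_of_not_rank_le hk hγ hN, EReal.top_add_coe]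
    exact le_top
  rw [mul_rankConstrained_of_rank_le hXr, mul_rankConstrained_of_rank_le hN]
  have hmem : X ∈ prox (fun M => (γ : EReal) * compNorm k (gaugeNorm g) M)
      (expand u v (trunc r (sigmaVec Z))) := by rw [hX]; rfl
  have hNt := trunc_eq_self r ((rank_le_iff_sigmaVec N r).1 hN)
  have h1 := hmem (expand u v (trunc r (sigmaVec N)))
  dsimp only at h1
  have hNg : gaugeNorm g (expand u v (trunc r (sigmaVec N)) : Matrix (Fin n) (Fin m) ℝ) =
      gaugeNorm g N := by rw [gaugeNorm_expand hg h.1 h.2, hNt]; rfl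
  rw [compNorm, compNorm, hNg] at h1
  have hXd := frobNorm_expand_trunc_sub_sq h.1 h.2 r (sigmaVec X) (sigmaVec Z)
  have hNd := frobNorm_expand_trunc_sub_sq h.1 h.2 r (sigmaVec N) (sigmaVec Z)
  have hNZ := frobNorm_expand_sigmaVec_sub_le h N
  rw [← h.eq_expand] at hXd hNd
  rw [← hXe] at hXd
  rw [hNt] at hNd
  rw [hNt] at h1
  -- Adding the constant tail turns distances to the truncation into distances to `Z`.
  have h2 := add_le_add_left h1
    ((1 / 2 * ∑ i, (sigmaVec Z i - trunc r (sigmaVec Z) i) ^ 2 : ℝ) : EReal)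
  rw [add_assoc, add_assoc, ← EReal.coe_add, ← EReal.coe_add, ← mul_add, ← mul_add, ← hXd,
    ← hNd] at h2
  exact h2.trans (add_le_add_right
    (by exact_mod_cast mul_le_mul_of_nonneg_left hNZ (by norm_num)) _)

include hr1 hrq

theorem exists_prox_lowRankNorm (Z : Matrix (Fin n) (Fin m) ℝ) : ∃ M,
    prox (fun M => (γ : EReal) * compNorm k (lowRankNorm g r) M) Z = {M} :=
  exists_prox_seminorm_eq_singleton hk hγ (lowRankSeminorm hg hr1 hrq) Z

/-! ### The residual of the low-rank proximal point -/

section residual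
variable {Z Mc : Matrix (Fin n) (Fin m) ℝ}
  (hMc : prox (fun M => (γ : EReal) * compNorm k (lowRankNorm g r) M) Z = {Mc})
  {u : Fin (min n m) → EuclideanSpace ℝ (Fin n)} {v : Fin (min n m) → EuclideanSpace ℝ (Fin m)}
  (h : IsSVD Z u v)
include hMc h

omit hk hγ in
theorem eq_expand_of_prox_lowRankNorm : Mc = expand u v (sigmaVec Mc) :=
  eq_expand_of_prox_eq_singleton
    (fun A B hAB => by simp only [compNorm, lowRankNorm_congr hg hr1 hrq hAB]) hMc h

omit hk hγ in
theorem sub_eq_expand_of_prox_lowRankNorm : Z - Mc = expand u v (sigmaVec Z - sigmaVec Mc) := by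
  rw [expand_sub, ← h.eq_expand, ← eq_expand_of_prox_lowRankNorm hg hr1 hrq hMc h]

theorem residual_dotProduct_le {x : Fin (min n m) → ℝ}
    (hx : lowRankNorm g r (expand u v x : Matrix (Fin n) (Fin m) ℝ) ≤ lowRankNorm g r Mc) :
    (sigmaVec Z - sigmaVec Mc) ⬝ᵥ x ≤ (sigmaVec Z - sigmaVec Mc) ⬝ᵥ sigmaVec Mc := by
  have h1 := matInner_sub_le_of_mem_prox hk hγ (lowRankSeminorm hg hr1 hrq) (Z := Z) (M := Mc)
    (M' := expand u v x) (by exact hMc ▸ rfl) hx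
  rw [sub_eq_expand_of_prox_lowRankNorm hg hr1 hrq hMc h, matInner_expand_self h.1 h.2]
    at h1
  refine h1.trans_eq ?_
  conv_lhs => rw [eq_expand_of_prox_lowRankNorm hg hr1 hrq hMc h,
    matInner_expand_self h.1 h.2]
  rw [sigmaVec_expand h.1 h.2 (sigmaVec_antitone _) (sigmaVec_nonneg _)]

/-- Flipping the sign of one coefficient of `Mc` preserves its norm, so normality forces a
nonnegative product with the residual; a zero coefficient leaves `sigmaVec Z i`. -/
theorem residual_nonneg (i) : 0 ≤ (sigmaVec Z - sigmaVec Mc) i := by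
  have hσ : sigmaVec (expand u v (sigmaVec Mc - (2 * sigmaVec Mc i) • Pi.single i 1) :
      Matrix (Fin n) (Fin m) ℝ) = sigmaVec Mc := by
    refine sigmaVec_expand_abs_perm h.1 h.2 (sigmaVec_antitone _) (sigmaVec_nonneg _) 1 fun j => ?_
    have h0 := sigmaVec_nonneg Mc j
    by_cases hj : j = i
    · subst hj
      simp only [Equiv.Perm.coe_one, id, Pi.sub_apply, Pi.smul_apply, Pi.single_eq_same, smul_eq_mul]
      rw [show sigmaVec Mc j - 2 * sigmaVec Mc j * 1 = -sigmaVec Mc j by ring, abs_neg,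
        abs_of_nonneg h0]
    · simp [hj, abs_of_nonneg h0]
  have h1 := residual_dotProduct_le hg hk hγ hr1 hrq hMc h (lowRankNorm_congr hg hr1 hrq hσ).le
  rw [dotProduct_sub, dotProduct_smul, dotProduct_single_one, smul_eq_mul] at h1
  rcases (sigmaVec_nonneg Mc i).eq_or_lt with h0 | h0
  · rw [Pi.sub_apply, ← h0, sub_zero]; exact sigmaVec_nonneg Z i
  · have : 0 ≤ (2 * sigmaVec Mc i) * (sigmaVec Z - sigmaVec Mc) i := by linarith
    exact nonneg_of_mul_nonneg_right this (by linarith)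

/-- Swapping two unequal coefficients of `Mc` preserves its norm, and normality then orders the
residual; equal coefficients inherit the order from `Z`. -/
theorem residual_antitone : Antitone (sigmaVec Z - sigmaVec Mc) := by
  intro i j hij
  rcases (sigmaVec_antitone Mc hij).eq_or_lt with h0 | h0
  · have := sigmaVec_antitone Z hij
    simp only [Pi.sub_apply]
    linarith
  have hne : i ≠ j := fun e => by subst e; exact lt_irrefl _ h0
  have hx : sigmaVec Mc ∘ Equiv.swap i j = sigmaVec Mc -
      (sigmaVec Mc i - sigmaVec Mc j) • (Pi.single i 1 - Pi.single j 1) := by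
    funext l
    by_cases hi : l = i
    · subst hi; simp [hne]
    · by_cases hj : l = j
      · subst hj; simp [hi]
      · simp [Equiv.swap_apply_of_ne_of_ne hi hj, hi, hj]
  have hσ : sigmaVec (expand u v (sigmaVec Mc ∘ Equiv.swap i j) : Matrix (Fin n) (Fin m) ℝ) =
      sigmaVec Mc :=
    sigmaVec_expand_abs_perm h.1 h.2 (sigmaVec_antitone _) (sigmaVec_nonneg _) (Equiv.swap i j)
      fun l => by simp [abs_of_nonneg (sigmaVec_nonneg Mc l)]
  have h1 := residual_dotProduct_le hg hk hγ hr1 hrq hMc h (lowRankNorm_congr hg hr1 hrq hσ).le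
  rw [hx, dotProduct_sub, dotProduct_smul, dotProduct_sub, dotProduct_single_one,
    dotProduct_single_one, smul_eq_mul] at h1
  have h2 : 0 ≤ (sigmaVec Mc i - sigmaVec Mc j) *
    ((sigmaVec Z - sigmaVec Mc) i - (sigmaVec Z - sigmaVec Mc) j) := by linarith
  have := nonneg_of_mul_nonneg_right h2 (sub_pos.2 h0)
  linarith

theorem sigmaVec_sub_of_prox_lowRankNorm : sigmaVec (Z - Mc) = sigmaVec Z - sigmaVec Mc := by
  rw [sub_eq_expand_of_prox_lowRankNorm hg hr1 hrq hMc h]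
  exact sigmaVec_expand h.1 h.2 (residual_antitone hg hk hγ hr1 hrq hMc h)
    (residual_nonneg hg hk hγ hr1 hrq hMc h)

/-- The residual attains equality in the duality between the low-rank norm and its dual. -/
theorem lowRankNorm_mul_dualGauge_le (h0 : 0 < lowRankNorm g r Mc) :
    lowRankNorm g r Mc * dualGauge g (trunc r (sigmaVec Z - sigmaVec Mc)) ≤
      (sigmaVec Z - sigmaVec Mc) ⬝ᵥ sigmaVec Mc := by
  rw [mul_comm, ← le_div_iff₀ h0]
  refine dualGauge_le hg fun x hx => ?_
  rw [le_div_iff₀ h0, ← trunc_dotProduct, dotProduct_comm, mul_comm, ← smul_eq_mul,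
    ← dotProduct_smul]
  -- The test point is truncated, so its low-rank norm is its gauge norm, and scaling puts it in the
  -- ball of `Mc`.
  refine residual_dotProduct_le hg hk hγ hr1 hrq hMc h ?_
  have e : lowRankNorm g r Mc • trunc r x = trunc r (lowRankNorm g r Mc • x) := by
    funext i
    simp only [trunc, Pi.smul_apply, smul_eq_mul]
    split_ifs <;> simp
  rw [lowRankNorm_eq_gaugeNorm hg hr1 hrq (by rw [e]; exact rank_expand_le u v r _),
    gaugeNorm_expand hg h.1 h.2, hg.smul, abs_of_pos h0]
  exact mul_le_of_le_one_right h0.le ((hg.trunc_le r x).trans hx)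

/-- The dual norm ignores the residual entry `r + 1`. Were `Mc` nonzero there, the gap would leave
room to raise this entry, violating the duality bound that the residual attains. -/
theorem rank_le_of_residual_gap (hgap : sigma Z (r + 1) ≤ sigma (Z - Mc) r) : Mc.rank ≤ r := by
  by_contra hrank
  have hrlt : r < min n m := by
    refine lt_of_le_of_ne hrq fun e => hrank ?_
    rw [e]
    exact le_min Mc.rank_le_height Mc.rank_le_width
  let i₀ : Fin (min n m) := ⟨r, hrlt⟩
  let i₁ : Fin (min n m) := ⟨r - 1, by omega⟩
  have hc0 : 0 < sigmaVec Mc i₀ := lt_of_le_of_ne (sigmaVec_nonneg Mc i₀) fun e =>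
    hrank ((rank_le_iff_sigma_eq_zero Mc r).2 e.symm)
  set w := sigmaVec Z - sigmaVec Mc with hw
  have hwa : Antitone w := residual_antitone hg hk hγ hr1 hrq hMc h
  have hw0 : ∀ i, 0 ≤ w i := residual_nonneg hg hk hγ hr1 hrq hMc h
  have hgap' : sigmaVec Z i₀ ≤ w i₁ := by
    rw [hw, ← sigmaVec_sub_of_prox_lowRankNorm hg hk hγ hr1 hrq hMc h]
    change sigma Z (r + 1) ≤ sigma (Z - Mc) (r - 1 + 1)
    rwa [Nat.sub_add_cancel hr1]
  have hlt : w i₀ < w i₁ := by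
    have : w i₀ = sigmaVec Z i₀ - sigmaVec Mc i₀ := rfl
    linarith
  have hNpos : 0 < lowRankNorm g r Mc := by
    refine lt_of_lt_of_le (lt_of_le_of_ne (hg.nonneg _) fun e => ?_)
      (gaugeNorm_le_lowRankNorm hg hr1 hrq Mc)
    rw [congrFun ((hg.eq_zero_iff _).1 e.symm) i₀] at hc0
    exact lt_irrefl _ hc0
  have hle := lowRankNorm_mul_dualGauge_le hg hk hγ hr1 hrq hMc h hNpos
  rw [← hw] at hle
  -- Raising the entry exactly to its predecessor is what keeps the vector sorted, so that its
  -- truncation still computes the dual norm.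
  set w' := Function.update w i₀ (w i₁) with hw'
  have hw'a : Antitone w' := by
    intro i j hij
    simp only [hw', Function.update_apply]
    split_ifs with hj hi hi
    · exact le_rfl
    · refine hwa (Fin.le_def.2 ?_)
      have h1 : (i : ℕ) ≠ r := fun e => hi (Fin.ext e)
      have h2 : (i : ℕ) ≤ r := by rw [hj] at hij; exact hij
      change (i : ℕ) ≤ r - 1
      omega
    · exact (hwa (hi ▸ hij)).trans hlt.le
    · exact hwa hij
  have hw'0 : ∀ i, 0 ≤ w' i := by
    intro i
    simp only [hw', Function.update_apply]
    split_ifs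
    · exact hw0 _
    · exact hw0 _
  have htr : trunc r w' = trunc r w := by
    funext i
    unfold trunc
    split_ifs with hi
    · exact Function.update_of_ne (fun e => by subst e; exact lt_irrefl _ hi) _ _
    · rfl
  have hdual := matInner_le_lowRankNorm_mul hg hr1 hrq Mc (expand u v w')
  rw [truncDualNorm_eq, sigmaVec_expand h.1 h.2 hw'a hw'0, htr] at hdual
  have hin : matInner Mc (expand u v w') = sigmaVec Mc ⬝ᵥ w' := by
    conv_lhs => rw [eq_expand_of_prox_lowRankNorm hg hr1 hrq hMc h,
      matInner_expand_self h.1 h.2]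
  have hw'e : w' = w + (w i₁ - w i₀) • Pi.single i₀ 1 := by
    funext i
    by_cases hi : i = i₀
    · subst hi; simp [hw']
    · simp [hw', hi]
  rw [hin, hw'e, dotProduct_add, dotProduct_smul, dotProduct_single_one, smul_eq_mul,
    dotProduct_comm] at hdual
  have := mul_pos (sub_pos.2 hlt) hc0
  linarith

end residual
end

end LowRankProx
end

/-! ### Assembly of the theorem -/

open LowRankProx in
theorem mainTheorem1 {n m : ℕ} (g : (Fin (min n m) → ℝ) → ℝ)
    (hg : LowRankProx.IsSymmetricGauge g)
    (k : ℝ≥0 → EReal) (hk : LowRankProx.IsProperClosedConvexIncreasing k)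
    (r : ℕ) (hr1 : 1 ≤ r) (hrq : r ≤ min n m) (γ : ℝ) (hγ : 0 < γ)
    (Z : Matrix (Fin n) (Fin m) ℝ) :
    (∀ P ∈ LowRankProx.svdTrunc r Z, ∃ X : Matrix (Fin n) (Fin m) ℝ,
      LowRankProx.prox
          (fun M => (γ : EReal) * LowRankProx.compNorm k (LowRankProx.gaugeNorm g) M) P = {X} ∧
      LowRankProx.prox
          (fun M => (γ : EReal) * LowRankProx.compNorm k (LowRankProx.lowRankNorm g r) M) P = {X} ∧
      X ∈ LowRankProx.prox (fun M => (γ : EReal) * LowRankProx.rankConstrained k g r M) Z) ∧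
    (∃ Mc : Matrix (Fin n) (Fin m) ℝ,
      LowRankProx.prox
          (fun M => (γ : EReal) * LowRankProx.compNorm k (LowRankProx.lowRankNorm g r) M) Z = {Mc} ∧
      List.TFAE [
        LowRankProx.prox (fun M => (γ : EReal) * LowRankProx.rankConstrained k g r M) Z = {Mc},
        Mc.rank ≤ r,
        ∀ j ∈ Finset.Icc 1 (min n m - r),
          LowRankProx.sigma (Z - Mc) (r + j) = LowRankProx.sigma Z (r + j),
        LowRankProx.sigma (Z - Mc) r ≥ LowRankProx.sigma Z (r + 1)]) := by
  refine ⟨?_, ?_⟩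
  · rintro P ⟨u, v, h, hP⟩
    have hPe : P = expand u v (trunc r (sigmaVec Z)) := by
      rw [hP]
      refine Finset.sum_congr rfl fun i _ => ?_
      unfold trunc
      split_ifs <;> simp
    subst hPe
    obtain ⟨X, hX⟩ := exists_prox_gaugeNorm hg hk hγ (expand u v (trunc r (sigmaVec Z)))
    refine ⟨X, hX, ?_, ?_⟩
    · refine prox_eq_singleton_of_le hX
        (fun M => mul_compNorm_le hk hγ (gaugeNorm_le_lowRankNorm hg hr1 hrq M)) ?_
      have hXr : X.rank ≤ r := by
        rw [prox_gaugeNorm_trunc hg hk hγ h.1 h.2 (sigmaVec_antitone Z) (sigmaVec_nonneg Z)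
          hX]
        exact rank_expand_le u v r _
      simp only [compNorm, lowRankNorm_eq_gaugeNorm hg hr1 hrq hXr]
    · exact prox_gaugeNorm_mem_prox_rankConstrained hg hk hγ h hX
  · obtain ⟨Mc, hMc⟩ := exists_prox_lowRankNorm hg hk hγ hr1 hrq Z
    obtain ⟨u, v, h⟩ := exists_isSVD Z
    have hσ := sigmaVec_sub_of_prox_lowRankNorm hg hk hγ hr1 hrq hMc h
    refine ⟨Mc, hMc, ?_⟩
    tfae_have 1 → 2 := by
      intro h1
      by_contra hr
      have hmem : Mc ∈ prox (fun M => (γ : EReal) * rankConstrained k g r M) Z := by rw [h1]; rfl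
      -- The zero matrix is feasible with finite value, so a minimizer cannot violate the rank
      -- constraint.
      have h2 := hmem 0
      dsimp only at h2
      rw [mul_rankConstrained_of_not_rank_le hk hγ hr, mul_rankConstrained_of_rank_le (by simp),
        EReal.top_add_coe, top_le_iff, compNorm, gaugeNorm_zero hg, Real.toNNReal_zero] at h2
      have h0 := hk.zero_ne_top
      have h0' := hk.ne_bot 0
      lift k 0 to ℝ using ⟨h0, h0'⟩ with a
      exact EReal.coe_ne_top _ (by exact_mod_cast h2)
    tfae_have 2 → 1 := by
      intro hr
      refine prox_eq_singleton_of_le hMc (fun M => ?_) ?_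
      · by_cases hM : M.rank ≤ r
        · rw [mul_rankConstrained_of_rank_le hM]
          exact mul_compNorm_le hk hγ (lowRankNorm_eq_gaugeNorm hg hr1 hrq hM).le
        · rw [mul_rankConstrained_of_not_rank_le hk hγ hM]
          exact le_top
      · rw [mul_rankConstrained_of_rank_le hr]
        simp only [compNorm, lowRankNorm_eq_gaugeNorm hg hr1 hrq hr]
    tfae_have 2 → 3 := by
      intro hr j hj
      rw [Finset.mem_Icc] at hj
      have hlt : r + j - 1 < min n m := by omega
      have h1 := congrFun hσ ⟨r + j - 1, hlt⟩
      rw [Pi.sub_apply, (rank_le_iff_sigmaVec Mc r).1 hr ⟨r + j - 1, hlt⟩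
        (by change r ≤ r + j - 1; omega), sub_zero] at h1
      have e : r + j = r + j - 1 + 1 := by omega
      rw [e]
      exact h1
    tfae_have 3 → 4 := by
      intro h3
      by_cases hr : r < min n m
      · rw [← h3 1 (Finset.mem_Icc.2 ⟨le_rfl, by omega⟩)]
        exact LinearMap.singularValues_antitone _ (by omega)
      -- For `r = min n m` condition 3 is vacuous, and condition 4 holds by the convention that the
      -- next singular value is zero.
      · rw [sigma_eq_zero_of_min_lt Z (by omega)]
        exact sigma_nonneg _ _
    tfae_have 4 → 2 := rank_le_of_residual_gap hg hk hγ hr1 hrq hMc h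
    tfae_finish
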